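/- Write $H(n):=0!\,1!\cdots(n-1)!$, and for $n\in\mathbb Z$ let $(z)_n$ be the Pochhammer symbol, $(z)_n=z(z+1)\cdots(z+n-1)$ if $n\ge 0$ and $(z)_n=\frac{1}{(z-1)(z-2)\cdots(z-|n|)}$ if $n<0$. A lozenge is the union of two unit triangles of the triangular lattice that share a side, and $M(R)$ is the number of lozenge tilings of a region $R$ (a finite set of unit triangles), that is, of partitions of $R$ into lozenges. Let $a,b,c,k,l,m$ be non-negative integers with $b\le c$, $0\le l\le b+c$ and $m\le\min(b,l,b+c-l)$. Consider the lattice hexagon with side lengths $a,\ b+k,\ c,\ a+k,\ b,\ c+k$ in clockwise order, starting with the horizontal top side. For $0\le l'\le b+c$ the horizontal lattice line at height $l'$ (in lattice steps) above the bottom side, called the $l'$-th line, meets the hexagon in a segment of length $L(l')=a+k-l'+\min(b,l')+\min(c,l')$; note that $L(l)=L(b+c-l)$. For sets $X,Y\subseteq\{1,\dots,L(l')\}$ let $H_{a,b,c}^{k,l'}(X:Y)$ be the region obtained from the hexagon by removing the up-pointing unit triangles whose horizontal sides are the unit segments of the $l'$-th line with labels in $X$, and the down-pointing unit triangles whose horizontal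 sides are the unit segments of that line with labels in $Y$, where the unit segments of the line are labelled $1,2,\dots,L(l')$ from left to right. Let $\overline H_{a,b,c}^{k,l'}(X:Y)$ be the region defined in the same way but with the labels $1,2,\dots,L(l')$ running from right to left. **Theorem 2.1.** Let $X=\{x_1,\dots,x_{m+k}\}$ and $Y=\{y_1,\dots,y_m\}$ be subsets of $\{1,\dots,L(l)\}$ with $m+k$ and $m$ elements respectively (not necessarily disjoint), and put $$P=\frac{H(k+l)\,H(b+c-l)}{H(l)\,H(b+c+k-l)}\cdot\frac{\prod_{i=1}^{m+k}(x_i-b+\max(b,l))_{(b-l)}\,(a+k+\min(b,l)+1-x_i)_{(c-l)}}{\prod_{j=1}^{m}(y_j-b+\max(b,l))_{(b-l)}\,(a+k+\min(b,l)+1-y_j)_{(c-l)}} .$$ Then $P$ is well defined and positive, and $$M\big(H_{a,b,c}^{k,l}(X:Y)\big)=P\cdot M\big(\overline H_{a,b,c}^{k,b+c-l}(X:Y)\big).$$ In particular, if $M\big(\overline H_{a,b,c}^{k,b+c-l}(X:Y)\big)\neq 0$, then $$\frac{M\big(H_{a,b,c}^{k,l}(X:Y)\big)}{M\big(\overline H_{a,b,c}^{k,b+c-l}(X:Y)\big)}=P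 .$$ -/

import Mathlib

namespace Lozenge

/-- A unit triangle of the triangular lattice. Lattice points are pairs `(i, j) : ℤ × ℤ`, standing
for `i • e₁ + j • e₂` with `e₁ = (1, 0)` and `e₂ = (1/2, √3/2)`. The triangle `(i, j, true)` is the
up-pointing one, `(i, j, false)` the down-pointing one, of the unit rhombus spanned by
`e₁, e₂` at `(i, j)`. -/
abbrev UnitTriangle : Type := ℤ × ℤ × Bool

/-- The three vertices of a unit triangle. -/
def vertices : UnitTriangle → Finset (ℤ × ℤ)
  | (i, j, true) => {(i, j), (i + 1, j), (i, j + 1)}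
  | (i, j, false) => {(i + 1, j), (i, j + 1), (i + 1, j + 1)}

/-- The up-pointing unit triangle whose horizontal (bottom) side is the segment from `p` to
`p + e₁`. -/
def upOn (p : ℤ × ℤ) : UnitTriangle := (p.1, p.2, true)

/-- The down-pointing unit triangle whose horizontal (top) side is the segment from `p` to
`p + e₁`. -/
def downOn (p : ℤ × ℤ) : UnitTriangle := (p.1, p.2 - 1, false)

/-- A lozenge: the union of two unit triangles that have a side (exactly two vertices) in common. -/
def IsLozenge (P : Finset UnitTriangle) : Prop :=
  ∃ s t : UnitTriangle, (vertices s ∩ vertices t).card = 2 ∧ P = {s, t}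

/-- The number `M(R)` of lozenge tilings of a region `R` (a finite set of unit triangles): the
number of partitions of `R` into lozenges. -/
noncomputable def tilingCount (R : Finset UnitTriangle) : ℕ :=
  Nat.card {T : Finpartition R // ∀ P ∈ T.parts, IsLozenge P}

/-- The lattice points of the (closed) hexagon with side lengths `a, b+k, c, a+k, b, c+k`, clockwise
from the top side. Its bottom side goes from `(0, 0)` to `(a+k, 0)`; the corners, counterclockwise,
are `(0, 0)`, `(a+k, 0)`, `(a+k, c)`, `(a-b, b+c+k)`, `(-b, b+c+k)`, `(-b, b)`. -/
def InHexagon (a b c k : ℕ) (p : ℤ × ℤ) : Prop :=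
  (0 ≤ p.2 ∧ p.2 ≤ b + c + k) ∧ (-(b : ℤ) ≤ p.1 ∧ p.1 ≤ a + k) ∧
    (0 ≤ p.1 + p.2 ∧ p.1 + p.2 ≤ a + k + c)

instance (a b c k : ℕ) : DecidablePred (InHexagon a b c k) := fun p => by
  unfold InHexagon; infer_instance

/-- The hexagon with side lengths `a, b+k, c, a+k, b, c+k`, clockwise from the top side, as the set
of the unit triangles that it contains. -/
noncomputable def hexagon (a b c k : ℕ) : Finset UnitTriangle :=
  (Finset.Icc (-(b : ℤ)) (a + k) ×ˢ Finset.Icc (0 : ℤ) (b + c + k) ×ˢ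
      (Finset.univ : Finset Bool)).filter
    fun t => ∀ p ∈ vertices t, InHexagon a b c k p

/-- Length `L(l)` of the `l`-th horizontal line (at height `l` above the bottom side) of the
hexagon, for `l ≤ b + c`. In that range the subtraction does not truncate. -/
def lineLength (a b c k l : ℕ) : ℕ := a + k + min b l + min c l - l

/-- Left endpoint of the unit segment on the `l`-th horizontal line with label `t`, where the
segments are labelled `1, 2, …, L(l)` from left to right. The leftmost point of the hexagon on that
line is `(-min b l, l)`. -/
def segLR (b l : ℕ) (t : ℕ) : ℤ × ℤ := (-((min b l : ℕ) : ℤ) + t - 1, l)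

/-- Left endpoint of the unit segment on the `l`-th horizontal line with label `t`, where the
segments are labelled `1, 2, …, L(l)` from right to left. -/
def segRL (a b c k l : ℕ) (t : ℕ) : ℤ × ℤ :=
  (-((min b l : ℕ) : ℤ) + lineLength a b c k l - t, l)

/-- The region `H_{a,b,c}^{k,l}(X : Y)`: the hexagon without the up-pointing unit triangles with
labels in `X` and the down-pointing unit triangles with labels in `Y` on the `l`-th horizontal line,
labelled from left to right. -/
noncomputable def region (a b c k l : ℕ) (X Y : Finset ℕ) : Finset UnitTriangle :=
  hexagon a b c k \
    (X.image (fun x => upOn (segLR b l x)) ∪ Y.image (fun y => downOn (segLR b l y)))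

/-- The region `H̄_{a,b,c}^{k,l}(X : Y)`: as `region`, but labelled from right to left. -/
noncomputable def regionBar (a b c k l : ℕ) (X Y : Finset ℕ) : Finset UnitTriangle :=
  hexagon a b c k \
    (X.image (fun x => upOn (segRL a b c k l x)) ∪ Y.image (fun y => downOn (segRL a b c k l y)))

/-- The hyperfactorial `H(n) = 0! 1! ⋯ (n-1)!`. -/
def hyperfactorial (n : ℕ) : ℕ := ∏ i ∈ Finset.range n, Nat.factorial i

/-- The Pochhammer symbol `(z)_n` for integer `n`: `z (z+1) ⋯ (z+n-1)` for `n ≥ 0`, and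
`1 / ((z-1) (z-2) ⋯ (z-|n|))` for `n < 0`. -/
def poch (z : ℚ) : ℤ → ℚ
  | Int.ofNat n => ∏ i ∈ Finset.range n, (z + i)
  | Int.negSucc n => (∏ i ∈ Finset.range (n + 1), (z - (i + 1)))⁻¹

/-- The factor `(z - b + max(b,l))_{b-l} · (a + k + min(b,l) + 1 - z)_{c-l}` contributed by a hole
with label `z`. -/
def holeFactor (a b c k l : ℕ) (z : ℕ) : ℚ :=
  poch ((z : ℚ) - b + max (b : ℚ) l) ((b : ℤ) - l) *
    poch ((a : ℚ) + k + min (b : ℚ) l + 1 - z) ((c : ℤ) - l)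

/-- The product formula for the ratio of the two tiling counts. -/
def productFormula (a b c k l : ℕ) (X Y : Finset ℕ) : ℚ :=
  ((hyperfactorial (k + l) : ℚ) * hyperfactorial (b + c - l)) /
      ((hyperfactorial l : ℚ) * hyperfactorial (b + c + k - l)) *
    ((∏ x ∈ X, holeFactor a b c k l x) / ∏ y ∈ Y, holeFactor a b c k l y)

end Lozenge

/-!
Cut the hexagon along the line that carries the holes. A tiling is determined by the set `Z` of
positions at which a vertical lozenge crosses the line, and by a tiling of each of the two parts that
remain when the triangles covered by these lozenges are removed (`tilingCount_cut`). The lower part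
is a trapezoid with cut-off corners whose top side has dents at `Y ∪ Z`. Cutting off a corner has the
same effect as a block of consecutive dents there, since these force the lozenges in the corner. A
trapezoid of height `h` with set of dents `S` on its long side has `∏ (t - s) / H(h)` tilings, the
product being over the pairs `s < t` of elements of `S`, if `S` has `h` elements, and none otherwise
(`tilingCount_lowerPart`): cutting off one
strip at a time, the dents on consecutive lines interlace (`tilingCount_strip`,
`balanced_sdiff_iff`), and summing the Vandermonde product over the sets that interlace with a given
set gives the next Vandermonde product up to a factorial (`sum_vdm_interlaces`). The upper part is
such a trapezoid as well, turned by `180°`, with dents at `X ∪ Z`.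

Hence both tiling counts of the theorem are sums over the same sets `Z`
(`tilingCount_holedHexagon`, `tilingCount_holedHexagon_reflect`). In terms of labels,
passing from the line at height `l` to that at height `b + c - l`, with the reverse labelling,
exchanges the corner blocks of the lower and of the upper part. Split each Vandermonde product into
the products inside the dents, inside the corner blocks, and between the two. The first two
occur in both sums. In the last, every element of `Z` is compared with both kinds of corner blocks,
so that `Z` contributes the same to both sums, while elements of `X` and of `Y` contribute the ratio
of their distances to the two kinds of blocks or its inverse (`dentWeight_exchange`). The sums are
therefore proportional term by term. The ratio of distances is the product of Pochhammer symbols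
in the theorem (`holeFactor_eq`), and the hyperfactorials are the denominators `H(h)` of the four
trapezoids.
-/

namespace Lozenge

/-! ### Lozenges and tilings -/

/-- A lozenge consists of an up-pointing triangle and the down-pointing triangle to its right, to its
left or below it. -/
lemma isLozenge_iff (P : Finset UnitTriangle) : IsLozenge P ↔ ∃ i j : ℤ,
    P = {(i, j, true), (i, j, false)} ∨ P = {(i, j, true), (i - 1, j, false)} ∨
      P = {(i, j, true), (i, j - 1, false)} := by
  constructor
  · rintro ⟨⟨i, j, s⟩, ⟨i', j', t⟩, h, rfl⟩
    obtain ⟨p, q, hpq, hpq'⟩ := Finset.card_eq_two.1 h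
    have hp : p ∈ vertices (i, j, s) ∩ vertices (i', j', t) := by simp [hpq']
    have hq : q ∈ vertices (i, j, s) ∩ vertices (i', j', t) := by simp [hpq']
    obtain ⟨p1, p2⟩ := p
    obtain ⟨q1, q2⟩ := q
    cases s <;> cases t
    · have : i = i' ∧ j = j' := by
        simp only [vertices, Finset.mem_inter, Finset.mem_insert, Finset.mem_singleton,
          Prod.mk.injEq, ne_eq] at hp hq hpq
        omega
      obtain ⟨rfl, rfl⟩ := this
      simp [vertices] at h
    · have : (i = i' ∧ j = j') ∨ (i = i' - 1 ∧ j = j') ∨ (i = i' ∧ j = j' - 1) := by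
        simp only [vertices, Finset.mem_inter, Finset.mem_insert, Finset.mem_singleton,
          Prod.mk.injEq, ne_eq] at hp hq hpq
        omega
      refine ⟨i', j', ?_⟩
      rw [Finset.pair_comm]
      rcases this with ⟨rfl, rfl⟩ | ⟨rfl, rfl⟩ | ⟨rfl, rfl⟩ <;> simp
    · have : (i' = i ∧ j' = j) ∨ (i' = i - 1 ∧ j' = j) ∨ (i' = i ∧ j' = j - 1) := by
        simp only [vertices, Finset.mem_inter, Finset.mem_insert, Finset.mem_singleton,
          Prod.mk.injEq, ne_eq] at hp hq hpq
        omega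
      refine ⟨i, j, ?_⟩
      rcases this with ⟨rfl, rfl⟩ | ⟨rfl, rfl⟩ | ⟨rfl, rfl⟩ <;> simp
    · have : i = i' ∧ j = j' := by
        simp only [vertices, Finset.mem_inter, Finset.mem_insert, Finset.mem_singleton,
          Prod.mk.injEq, ne_eq] at hp hq hpq
        omega
      obtain ⟨rfl, rfl⟩ := this
      simp [vertices] at h
  · rintro ⟨i, j, rfl | rfl | rfl⟩
    · refine ⟨_, _, ?_, rfl⟩
      have : vertices (i, j, true) ∩ vertices (i, j, false) = {(i + 1, j), (i, j + 1)} := by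
        ext ⟨x, y⟩
        simp only [vertices, Finset.mem_inter, Finset.mem_insert, Finset.mem_singleton,
          Prod.mk.injEq]
        omega
      rw [this, Finset.card_pair (by simp)]
    · refine ⟨_, _, ?_, rfl⟩
      have : vertices (i, j, true) ∩ vertices (i - 1, j, false) = {(i, j), (i, j + 1)} := by
        ext ⟨x, y⟩
        simp only [vertices, Finset.mem_inter, Finset.mem_insert, Finset.mem_singleton,
          Prod.mk.injEq]
        omega
      rw [this, Finset.card_pair (by simp)]
    · refine ⟨_, _, ?_, rfl⟩
      have : vertices (i, j, true) ∩ vertices (i, j - 1, false) = {(i, j), (i + 1, j)} := by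
        ext ⟨x, y⟩
        simp only [vertices, Finset.mem_inter, Finset.mem_insert, Finset.mem_singleton,
          Prod.mk.injEq]
        omega
      rw [this, Finset.card_pair (by simp)]

/-- Which pairs consisting of an up-pointing and a down-pointing triangle are lozenges. -/
lemma isLozenge_up_down (i j i' j' : ℤ) : IsLozenge {(i, j, true), (i', j', false)} ↔
    (i' = i ∧ j' = j) ∨ (i' = i - 1 ∧ j' = j) ∨ (i' = i ∧ j' = j - 1) := by
  rw [isLozenge_iff]
  constructor
  · rintro ⟨x, y, h⟩
    have h1 : ∀ P : Finset UnitTriangle, ({(i, j, true), (i', j', false)} : Finset _) = P →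
      (i, j, true) ∈ P ∧ (i', j', false) ∈ P := by rintro _ rfl; simp
    rcases h with h | h | h <;> have := h1 _ h <;> simp at this <;> omega
  · rintro (⟨h, h'⟩ | ⟨h, h'⟩ | ⟨h, h'⟩) <;> subst h h'
    exacts [⟨_, _, .inl rfl⟩, ⟨_, _, .inr (.inl rfl)⟩, ⟨_, _, .inr (.inr rfl)⟩]

lemma not_isLozenge_same (i j i' j' : ℤ) (s : Bool) : ¬ IsLozenge {(i, j, s), (i', j', s)} := by
  rw [isLozenge_iff]
  rintro ⟨x, y, h⟩
  have h1 : ∀ P : Finset UnitTriangle, ({(i, j, s), (i', j', s)} : Finset _) = P →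
      ∀ t ∈ P, t.2.2 = s := by rintro _ rfl; simp
  rcases h with h | h | h <;> have := h1 _ h <;> simp at this

/-- `F` is the set of the tiles of a lozenge tiling of `R`. -/
def IsTiling (R : Finset UnitTriangle) (F : Finset (Finset UnitTriangle)) : Prop :=
  (∀ P ∈ F, IsLozenge P ∧ P ⊆ R) ∧ ∀ t ∈ R, ∃! P, P ∈ F ∧ t ∈ P

lemma IsLozenge.nonempty {P : Finset UnitTriangle} (h : IsLozenge P) : P.Nonempty := by
  obtain ⟨s, t, -, rfl⟩ := h
  exact ⟨s, by simp⟩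

lemma IsTiling.eq_of_mem {R F} (h : IsTiling R F) {P Q : Finset UnitTriangle} {t : UnitTriangle}
    (hP : P ∈ F) (hQ : Q ∈ F) (tP : t ∈ P) (tQ : t ∈ Q) : P = Q :=
  (h.2 t ((h.1 P hP).2 tP)).unique ⟨hP, tP⟩ ⟨hQ, tQ⟩

open Classical in
/-- The finite set of all lozenge tilings of `R`. -/
noncomputable def tilings (R : Finset UnitTriangle) : Finset (Finset (Finset UnitTriangle)) :=
  R.powerset.powerset.filter (IsTiling R)

lemma mem_tilings {R F} : F ∈ tilings R ↔ IsTiling R F := by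
  classical
  simp only [tilings, Finset.mem_filter, Finset.mem_powerset, and_iff_right_iff_imp]
  intro h P hP
  exact Finset.mem_powerset.2 (h.1 P hP).2

lemma tilingCount_eq_card (R : Finset UnitTriangle) : tilingCount R = (tilings R).card := by
  rw [tilingCount, ← Nat.card_eq_finsetCard]
  refine Nat.card_congr ⟨fun T => ⟨T.1.parts, ?_⟩, 
    fun F => ⟨Finpartition.ofExistsUnique F.1 ?_ ?_ ?_, ?_⟩,
    fun T => ?_, fun F => ?_⟩
  · exact (mem_tilings.2 ⟨fun P hP => ⟨T.2 P hP, T.1.le hP⟩,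
      fun t ht => by simpa using T.1.existsUnique_mem ht⟩)
  · exact fun P hP => ((mem_tilings.1 F.2).1 P hP).2
  · exact fun t ht => (mem_tilings.1 F.2).2 t ht
  · exact fun h => by simpa using ((mem_tilings.1 F.2).1 _ h).1.nonempty
  · exact fun P hP => ((mem_tilings.1 F.2).1 P hP).1
  · ext; rfl
  · rfl

lemma tilingCount_empty : tilingCount ∅ = 1 := by
  rw [tilingCount_eq_card, Finset.card_eq_one]
  refine ⟨∅, ?_⟩
  ext F
  rw [mem_tilings, Finset.mem_singleton]
  constructor
  · intro h
    refine Finset.eq_empty_of_forall_notMem fun P hP => ?_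
    obtain ⟨t, ht⟩ := (h.1 P hP).1.nonempty
    simpa using (h.1 P hP).2 ht
  · rintro rfl
    simp [IsTiling]

lemma IsTiling.exists_pair {R F} (h : IsTiling R F) {t : UnitTriangle} (ht : t ∈ R) :
    ∃ v ∈ R, IsLozenge {t, v} ∧ {t, v} ∈ F := by
  obtain ⟨P, ⟨hP, htP⟩, -⟩ := h.2 t ht
  obtain ⟨hL, hPR⟩ := h.1 P hP
  obtain ⟨s, u, -, rfl⟩ := id hL
  rcases Finset.mem_insert.1 htP with rfl | h'
  · exact ⟨u, hPR (by simp), hL, hP⟩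
  · rw [Finset.mem_singleton] at h'
    subst h'
    rw [Finset.pair_comm] at hL hP
    exact ⟨s, hPR (by simp), hL, hP⟩

lemma tilingCount_eq_zero {R} {t : UnitTriangle} (ht : t ∈ R)
    (h : ∀ v ∈ R, ¬ IsLozenge {t, v}) : tilingCount R = 0 := by
  rw [tilingCount_eq_card, Finset.card_eq_zero]
  refine Finset.eq_empty_of_forall_notMem fun F hF => ?_
  obtain ⟨v, hv, hL, -⟩ := (mem_tilings.1 hF).exists_pair ht
  exact h v hv hL

/-- A triangle with a single neighbour in the region forces a lozenge. -/
lemma tilingCount_forced {R} {t u : UnitTriangle} (ht : t ∈ R) (hu : u ∈ R)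
    (hL : IsLozenge {t, u}) (h : ∀ v ∈ R, IsLozenge {t, v} → v = u) :
    tilingCount R = tilingCount (R \ {t, u}) := by
  have key : ∀ F, IsTiling R F → {t, u} ∈ F := by
    intro F hF
    obtain ⟨v, hv, hL', hF'⟩ := hF.exists_pair ht
    rwa [h v hv hL'] at hF'
  have hsub : ({t, u} : Finset UnitTriangle) ⊆ R := by
    intro x hx; grind
  rw [tilingCount_eq_card, tilingCount_eq_card]
  refine Finset.card_nbij' (fun F => F.erase {t, u}) (fun F => insert {t, u} F) ?_ ?_ ?_ ?_
  · intro F hF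
    have hF := mem_tilings.1 (Finset.mem_coe.1 hF)
    have hk := key F hF
    refine Finset.mem_coe.2 (mem_tilings.2 ⟨fun P hP => ?_, fun x hx => ?_⟩)
    · obtain ⟨hne, hP⟩ := Finset.mem_erase.1 hP
      refine ⟨(hF.1 P hP).1, fun x hx => Finset.mem_sdiff.2 ⟨(hF.1 P hP).2 hx, fun hx' => hne ?_⟩⟩
      exact hF.eq_of_mem hP hk hx hx'
    · obtain ⟨hx, hx'⟩ := Finset.mem_sdiff.1 hx
      obtain ⟨P, ⟨hP, hxP⟩, -⟩ := hF.2 x hx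
      refine ⟨P, ⟨Finset.mem_erase.2 ⟨?_, hP⟩, hxP⟩, ?_⟩
      · rintro rfl; exact hx' hxP
      · rintro Q ⟨hQ, hxQ⟩
        exact hF.eq_of_mem (Finset.mem_of_mem_erase hQ) hP hxQ hxP
  · intro F hF
    have hF := mem_tilings.1 (Finset.mem_coe.1 hF)
    refine Finset.mem_coe.2 (mem_tilings.2 ⟨fun P hP => ?_, fun x hx => ?_⟩)
    · rcases Finset.mem_insert.1 hP with rfl | hP
      · exact ⟨hL, hsub⟩
      · exact ⟨(hF.1 P hP).1, (hF.1 P hP).2.trans Finset.sdiff_subset⟩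
    · by_cases hx' : x ∈ ({t, u} : Finset UnitTriangle)
      · refine ⟨{t, u}, ⟨by simp, hx'⟩, ?_⟩
        rintro Q ⟨hQ, hxQ⟩
        rcases Finset.mem_insert.1 hQ with rfl | hQ
        · rfl
        · exact absurd hx' (Finset.mem_sdiff.1 ((hF.1 Q hQ).2 hxQ)).2
      · obtain ⟨P, ⟨hP, hxP⟩, -⟩ := hF.2 x (Finset.mem_sdiff.2 ⟨hx, hx'⟩)
        refine ⟨P, ⟨by simp [hP], hxP⟩, ?_⟩
        rintro Q ⟨hQ, hxQ⟩
        rcases Finset.mem_insert.1 hQ with rfl | hQ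
        · exact absurd hxQ hx'
        · exact hF.eq_of_mem hQ hP hxQ hxP
  · intro F hF
    exact Finset.insert_erase (key F (mem_tilings.1 (Finset.mem_coe.1 hF)))
  · intro F hF
    have hF := mem_tilings.1 (Finset.mem_coe.1 hF)
    refine Finset.erase_insert fun h' => ?_
    exact absurd ((hF.1 _ h').2 (Finset.mem_insert_self t {u})) (by simp)

/-- Tiling counts are invariant under bijections of the lattice that preserve lozenges. -/
lemma tilingCount_map (e : UnitTriangle ≃ UnitTriangle)
    (he : ∀ P : Finset UnitTriangle, IsLozenge (P.map e.toEmbedding) ↔ IsLozenge P)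
    (R : Finset UnitTriangle) : tilingCount (R.map e.toEmbedding) = tilingCount R := by
  -- `E` moves single tiles.
  let E := (Finset.mapEmbedding e.toEmbedding).toEmbedding
  have hE : ∀ P, E P = P.map e.toEmbedding := fun P => rfl
  have main : ∀ F, IsTiling (R.map e.toEmbedding) (F.map E) ↔ IsTiling R F := by
    intro F
    simp only [IsTiling, Finset.forall_mem_map, hE, he, Finset.map_subset_map]
    refine and_congr Iff.rfl (forall₂_congr fun t _ => ?_)
    constructor
    · rintro ⟨P, ⟨hP, ht⟩, hu⟩
      obtain ⟨Q, hQ, rfl⟩ := Finset.mem_map.1 hP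
      refine ⟨Q, ⟨hQ, by simpa [hE] using ht⟩, fun Q' hQ' => E.injective (hu _ ⟨?_, ?_⟩)⟩
      · exact Finset.mem_map_of_mem _ hQ'.1
      · simpa [hE] using hQ'.2
    · rintro ⟨P, ⟨hP, ht⟩, hu⟩
      refine ⟨E P, ⟨Finset.mem_map_of_mem _ hP, by simpa [hE] using ht⟩, ?_⟩
      rintro Q ⟨hQ, htQ⟩
      obtain ⟨Q, hQ, rfl⟩ := Finset.mem_map.1 hQ
      rw [hu Q ⟨by simpa using hQ, by simpa [hE] using htQ⟩]
  rw [tilingCount_eq_card, tilingCount_eq_card,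
    ← Finset.card_map (s := tilings R) ⟨_, Finset.map_injective E⟩]
  congr 1
  ext F
  rw [Finset.mem_map, mem_tilings]
  constructor
  · intro hF
    refine ⟨F.map (Finset.mapEmbedding e.symm.toEmbedding).toEmbedding, ?_, ?_⟩
    · rw [mem_tilings, ← main]
      convert hF
      ext P
      simp [E, Finset.mem_map, Finset.map_map]
    · ext P
      simp [E, Finset.mem_map, Finset.map_map]
  · rintro ⟨F, hF, rfl⟩
    exact (main F).2 (mem_tilings.1 hF)

/-! ### Cutting a region along a horizontal line -/

open Classical in
/-- Cutting a region along the horizontal line at height `j`: a tiling is determined by the set `Z`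
of positions at which a vertical lozenge crosses the line, a tiling of the part below the line and
a tiling of the part above it. -/
lemma tilingCount_cut (R : Finset UnitTriangle) (j : ℤ) (C : Finset ℤ)
    (hC : ∀ i, i ∈ C ↔ upOn (i, j) ∈ R ∧ downOn (i, j) ∈ R) :
    tilingCount R = ∑ Z ∈ C.powerset,
      tilingCount (R.filter (fun t => t.2.1 < j) \ Z.image (fun i => downOn (i, j))) *
        tilingCount (R.filter (fun t => ¬ t.2.1 < j) \ Z.image (fun i => upOn (i, j))) := by
  -- The vertical lozenge that crosses the line at position `i`. All other lozenges lie on one side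
  -- of the line.
  let cr : ℤ → Finset UnitTriangle := fun i => {upOn (i, j), downOn (i, j)}
  have cr_inj : ∀ i i', cr i = cr i' → i = i' := by
    intro i i' h
    have : upOn (i, j) ∈ cr i' := by rw [← h]; simp [cr]
    simpa [cr, upOn, downOn] using this
  have cr_loz : ∀ i, IsLozenge (cr i) := fun i => by
    simp only [cr, upOn, downOn, isLozenge_up_down]; simp
  have trich : ∀ P, IsLozenge P → 
      (∀ t ∈ P, t.2.1 < j) ∨ (∀ t ∈ P, ¬ t.2.1 < j) ∨ ∃ i, P = cr i := by
    intro P hP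
    obtain ⟨x, y, rfl | rfl | rfl⟩ := (isLozenge_iff P).1 hP
    · simp; omega
    · simp; omega
    · rcases lt_trichotomy y j with h | rfl | h
      · left; simp; omega
      · right; right; exact ⟨x, rfl⟩
      · right; left; simp; omega
  have cr_not : ∀ i, ¬ (∀ t ∈ cr i, t.2.1 < j) ∧ ¬ (∀ t ∈ cr i, ¬ t.2.1 < j) := by
    intro i; simp [cr, upOn, downOn]
  rw [tilingCount_eq_card]
  rw [Finset.card_eq_sum_card_fiberwise (f := fun F => C.filter (fun i => cr i ∈ F))
    (t := C.powerset)
    (fun F _ => Finset.mem_coe.2 (Finset.mem_powerset.2 (Finset.filter_subset _ _)))]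
  refine Finset.sum_congr rfl fun Z hZ => ?_
  rw [Finset.mem_powerset] at hZ
  rw [tilingCount_eq_card, tilingCount_eq_card, ← Finset.card_product]
  have hcr : ∀ {F}, IsTiling R F → (C.filter (fun i => cr i ∈ F) = Z) → ∀ i, cr i ∈ F ↔ i ∈ Z := by
    intro F hF h i
    rw [← h, Finset.mem_filter]
    refine ⟨fun hi => ⟨(hC i).2 ⟨?_, ?_⟩, hi⟩, fun hi => hi.2⟩ <;>
      exact (hF.1 _ hi).2 (by simp [cr])
  refine Finset.card_nbij' (fun F => (F.filter (fun P => ∀ t ∈ P, t.2.1 < j),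
      F.filter (fun P => ∀ t ∈ P, ¬ t.2.1 < j)))
    (fun F => F.1 ∪ F.2 ∪ Z.image cr) ?_ ?_ ?_ ?_
  · intro F hF
    obtain ⟨hF, hFZ⟩ := Finset.mem_filter.1 (Finset.mem_coe.1 hF)
    rw [mem_tilings] at hF
    have hc := hcr hF hFZ
    refine Finset.mem_coe.2 (Finset.mem_product.2 ⟨mem_tilings.2 ⟨?_, ?_⟩, mem_tilings.2 ⟨?_, ?_⟩⟩)
    · intro P hP
      obtain ⟨hP, hPj⟩ := Finset.mem_filter.1 hP
      refine ⟨(hF.1 P hP).1, fun t ht => Finset.mem_sdiff.2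
        ⟨Finset.mem_filter.2 ⟨(hF.1 P hP).2 ht, hPj t ht⟩, fun h' => ?_⟩⟩
      obtain ⟨i, hi, rfl⟩ := Finset.mem_image.1 h'
      have := hF.eq_of_mem hP ((hc i).2 hi) ht (by simp [cr])
      exact (cr_not i).1 (this ▸ hPj)
    · intro t ht
      obtain ⟨ht, ht'⟩ := Finset.mem_sdiff.1 ht
      obtain ⟨ht, htj⟩ := Finset.mem_filter.1 ht
      obtain ⟨P, ⟨hP, htP⟩, -⟩ := hF.2 t ht
      refine ⟨P, ⟨Finset.mem_filter.2 ⟨hP, ?_⟩, htP⟩, ?_⟩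
      · rcases trich P (hF.1 P hP).1 with h | h | ⟨i, rfl⟩
        · exact h
        · exact absurd htj (h t htP)
        · refine absurd ?_ ht'
          have hi := (hc i).1 hP
          simp only [cr, Finset.mem_insert, Finset.mem_singleton] at htP
          rcases htP with rfl | rfl
          · simp [upOn] at htj
          · exact Finset.mem_image_of_mem _ hi
      · rintro Q ⟨hQ, htQ⟩
        exact hF.eq_of_mem (Finset.mem_filter.1 hQ).1 hP htQ htP
    · intro P hP
      obtain ⟨hP, hPj⟩ := Finset.mem_filter.1 hP
      refine ⟨(hF.1 P hP).1, fun t ht => Finset.mem_sdiff.2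
        ⟨Finset.mem_filter.2 ⟨(hF.1 P hP).2 ht, hPj t ht⟩, fun h' => ?_⟩⟩
      obtain ⟨i, hi, rfl⟩ := Finset.mem_image.1 h'
      have := hF.eq_of_mem hP ((hc i).2 hi) ht (by simp [cr])
      exact (cr_not i).2 (this ▸ hPj)
    · intro t ht
      obtain ⟨ht, ht'⟩ := Finset.mem_sdiff.1 ht
      obtain ⟨ht, htj⟩ := Finset.mem_filter.1 ht
      obtain ⟨P, ⟨hP, htP⟩, -⟩ := hF.2 t ht
      refine ⟨P, ⟨Finset.mem_filter.2 ⟨hP, ?_⟩, htP⟩, ?_⟩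
      · rcases trich P (hF.1 P hP).1 with h | h | ⟨i, rfl⟩
        · exact absurd (h t htP) htj
        · exact h
        · refine absurd ?_ ht'
          have hi := (hc i).1 hP
          simp only [cr, Finset.mem_insert, Finset.mem_singleton] at htP
          rcases htP with rfl | rfl
          · exact Finset.mem_image_of_mem _ hi
          · simp [downOn] at htj
      · rintro Q ⟨hQ, htQ⟩
        exact hF.eq_of_mem (Finset.mem_filter.1 hQ).1 hP htQ htP
  · rintro ⟨F, G⟩ hFG
    obtain ⟨hF, hG⟩ := Finset.mem_product.1 (Finset.mem_coe.1 hFG)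
    simp only [mem_tilings] at hF hG
    have hFs : ∀ P ∈ F, ∀ t ∈ P, t ∈ R ∧ t.2.1 < j ∧ ∀ i ∈ Z, t ∉ cr i := by
      intro P hP t ht
      obtain ⟨h1, h2⟩ := Finset.mem_sdiff.1 ((hF.1 P hP).2 ht)
      obtain ⟨h1, h3⟩ := Finset.mem_filter.1 h1
      refine ⟨h1, h3, fun i hi h => ?_⟩
      simp only [cr, Finset.mem_insert, Finset.mem_singleton] at h
      rcases h with rfl | rfl
      · simp [upOn] at h3
      · exact h2 (Finset.mem_image_of_mem _ hi)
    have hGs : ∀ P ∈ G, ∀ t ∈ P, t ∈ R ∧ ¬ t.2.1 < j ∧ ∀ i ∈ Z, t ∉ cr i := by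
      intro P hP t ht
      obtain ⟨h1, h2⟩ := Finset.mem_sdiff.1 ((hG.1 P hP).2 ht)
      obtain ⟨h1, h3⟩ := Finset.mem_filter.1 h1
      refine ⟨h1, h3, fun i hi h => ?_⟩
      simp only [cr, Finset.mem_insert, Finset.mem_singleton] at h
      rcases h with rfl | rfl
      · exact h2 (Finset.mem_image_of_mem _ hi)
      · simp [downOn] at h3
    have hT : IsTiling R (F ∪ G ∪ Z.image cr) := by
      refine ⟨fun P hP => ?_, fun t ht => ?_⟩
      · simp only [Finset.mem_union, Finset.mem_image] at hP
        rcases hP with (hP | hP) | ⟨i, hi, rfl⟩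
        · exact ⟨(hF.1 P hP).1, fun t ht => (hFs P hP t ht).1⟩
        · exact ⟨(hG.1 P hP).1, fun t ht => (hGs P hP t ht).1⟩
        · have := (hC i).1 (hZ hi)
          refine ⟨cr_loz i, fun t ht => ?_⟩
          simp only [cr, Finset.mem_insert, Finset.mem_singleton] at ht
          rcases ht with rfl | rfl
          exacts [this.1, this.2]
      · by_cases hz : ∃ i ∈ Z, t ∈ cr i
        · obtain ⟨i, hi, hti⟩ := hz
          refine ⟨cr i, ⟨by simp only [Finset.mem_union, Finset.mem_image]; grind, hti⟩, ?_⟩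
          rintro Q ⟨hQ, htQ⟩
          simp only [Finset.mem_union, Finset.mem_image] at hQ
          rcases hQ with (hQ | hQ) | ⟨i', hi', rfl⟩
          · exact absurd hti ((hFs Q hQ t htQ).2.2 i hi)
          · exact absurd hti ((hGs Q hQ t htQ).2.2 i hi)
          · have : i' = i := by
              simp only [cr, upOn, downOn, Finset.mem_insert, Finset.mem_singleton] at hti htQ
              grind
            rw [this]
        · push Not at hz
          by_cases htj : t.2.1 < j
          · obtain ⟨P, ⟨hP, htP⟩, hu⟩ := hF.2 t (by
              refine Finset.mem_sdiff.2 ⟨Finset.mem_filter.2 ⟨ht, htj⟩, fun h => ?_⟩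
              obtain ⟨i, hi, rfl⟩ := Finset.mem_image.1 h
              exact hz i hi (by simp [cr]))
            refine ⟨P, ⟨by simp [hP], htP⟩, ?_⟩
            rintro Q ⟨hQ, htQ⟩
            simp only [Finset.mem_union, Finset.mem_image] at hQ
            rcases hQ with (hQ | hQ) | ⟨i', hi', rfl⟩
            · exact hu Q ⟨hQ, htQ⟩
            · exact absurd htj (hGs Q hQ t htQ).2.1
            · exact absurd htQ (hz i' hi')
          · obtain ⟨P, ⟨hP, htP⟩, hu⟩ := hG.2 t (by
              refine Finset.mem_sdiff.2 ⟨Finset.mem_filter.2 ⟨ht, htj⟩, fun h => ?_⟩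
              obtain ⟨i, hi, rfl⟩ := Finset.mem_image.1 h
              exact hz i hi (by simp [cr]))
            refine ⟨P, ⟨by simp [hP], htP⟩, ?_⟩
            rintro Q ⟨hQ, htQ⟩
            simp only [Finset.mem_union, Finset.mem_image] at hQ
            rcases hQ with (hQ | hQ) | ⟨i', hi', rfl⟩
            · exact absurd (hFs Q hQ t htQ).2.1 htj
            · exact hu Q ⟨hQ, htQ⟩
            · exact absurd htQ (hz i' hi')
    refine Finset.mem_coe.2 (Finset.mem_filter.2 ⟨mem_tilings.2 hT, ?_⟩)
    ext i
    simp only [Finset.mem_filter, Finset.mem_union, Finset.mem_image]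
    constructor
    · rintro ⟨hi, (h | h) | ⟨i', hi', h⟩⟩
      · exact absurd (fun t ht => (hFs _ h t ht).2.1) (cr_not i).1
      · exact absurd (fun t ht => (hGs _ h t ht).2.1) (cr_not i).2
      · rwa [← cr_inj _ _ h]
    · exact fun hi => ⟨hZ hi, Or.inr ⟨i, hi, rfl⟩⟩
  · intro F hF
    obtain ⟨hF, hFZ⟩ := Finset.mem_filter.1 (Finset.mem_coe.1 hF)
    rw [mem_tilings] at hF
    have hc := hcr hF hFZ
    ext P
    simp only [Finset.mem_union, Finset.mem_filter, Finset.mem_image]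
    constructor
    · rintro ((h | h) | ⟨i, hi, rfl⟩)
      exacts [h.1, h.1, (hc i).2 hi]
    · intro hP
      rcases trich P (hF.1 P hP).1 with h | h | ⟨i, rfl⟩
      · exact Or.inl (Or.inl ⟨hP, h⟩)
      · exact Or.inl (Or.inr ⟨hP, h⟩)
      · exact Or.inr ⟨i, (hc i).1 hP, rfl⟩
  · rintro ⟨F, G⟩ hFG
    obtain ⟨hF, hG⟩ := Finset.mem_product.1 (Finset.mem_coe.1 hFG)
    simp only [mem_tilings] at hF hG
    have hFs : ∀ P ∈ F, ∀ t ∈ P, t.2.1 < j := fun P hP t ht =>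
      (Finset.mem_filter.1 (Finset.mem_sdiff.1 ((hF.1 P hP).2 ht)).1).2
    have hGs : ∀ P ∈ G, ∀ t ∈ P, ¬ t.2.1 < j := fun P hP t ht =>
      (Finset.mem_filter.1 (Finset.mem_sdiff.1 ((hG.1 P hP).2 ht)).1).2
    have hFne : ∀ P ∈ F, ∃ t, t ∈ P := fun P hP => (hF.1 P hP).1.nonempty
    have hGne : ∀ P ∈ G, ∃ t, t ∈ P := fun P hP => (hG.1 P hP).1.nonempty
    refine Prod.ext ?_ ?_
    · ext P
      simp only [Finset.mem_union, Finset.mem_filter, Finset.mem_image]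
      constructor
      · rintro ⟨(h | h) | ⟨i, hi, rfl⟩, hP⟩
        · exact h
        · obtain ⟨t, ht⟩ := hGne P h
          exact absurd (hP t ht) (hGs P h t ht)
        · exact absurd hP (cr_not i).1
      · exact fun h => ⟨Or.inl (Or.inl h), hFs P h⟩
    · ext P
      simp only [Finset.mem_union, Finset.mem_filter, Finset.mem_image]
      constructor
      · rintro ⟨(h | h) | ⟨i, hi, rfl⟩, hP⟩
        · obtain ⟨t, ht⟩ := hFne P h
          exact absurd (hFs P h t ht) (hP t ht)
        · exact h
        · exact absurd hP (cr_not i).2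
      · exact fun h => ⟨Or.inl (Or.inr h), hGs P h⟩

/-! ### Tilings of a strip -/

/-- The number of elements of `S` that are less than `t`. -/
def countLT (S : Finset ℤ) (t : ℤ) : ℕ := (S.filter (· < t)).card

lemma countLT_erase {S : Finset ℤ} {i : ℤ} (hi : i ∈ S) (t : ℤ) :
    countLT (S.erase i) t + (if i < t then 1 else 0) = countLT S t := by
  unfold countLT
  rw [Finset.filter_erase]
  split_ifs with h
  · exact Finset.card_erase_add_one (Finset.mem_filter.2 ⟨hi, h⟩)
  · rw [Finset.erase_eq_of_notMem (by simp [h]), add_zero]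

lemma countLT_eq_zero {S : Finset ℤ} {t : ℤ} (h : ∀ x ∈ S, t ≤ x) : countLT S t = 0 := by
  rw [countLT, Finset.card_eq_zero, Finset.filter_eq_empty_iff]
  exact fun x hx => not_lt.2 (h x hx)

lemma countLT_eq_card {S : Finset ℤ} {t : ℤ} (h : ∀ x ∈ S, x < t) : countLT S t = S.card := by
  rw [countLT, Finset.filter_true_of_mem h]

lemma countLT_succ (S : Finset ℤ) (t : ℤ) :
    countLT S (t + 1) = countLT S t + (if t ∈ S then 1 else 0) := by
  unfold countLT
  split_ifs with h
  · rw [← Finset.card_insert_of_notMem (a := t) (by simp)]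
    congr 1; ext x; simp only [Finset.mem_filter, Finset.mem_insert, Int.lt_add_one_iff]; grind
  · congr 1; ext x; simp only [Finset.mem_filter, Int.lt_add_one_iff, and_congr_right_iff]; grind

lemma countLT_sdiff {S U : Finset ℤ} (h : S ⊆ U) (t : ℤ) :
    countLT (U \ S) t + countLT S t = countLT U t := by
  unfold countLT
  rw [← Finset.card_union_of_disjoint, ← Finset.filter_union, Finset.sdiff_union_of_subset h]
  exact Finset.disjoint_filter_filter Finset.sdiff_disjoint

lemma countLT_Ico (u v t : ℤ) : (countLT (Finset.Ico u v) t : ℤ) = max 0 (min v t - u) := by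
  have : (Finset.Ico u v).filter (· < t) = Finset.Ico u (min v t) := by
    ext; simp only [Finset.mem_filter, Finset.mem_Ico]; omega
  rw [countLT, this, Int.card_Ico]
  omega

/-- The union of the up-pointing triangles `(i, j)` with `i ∈ A` and the down-pointing triangles
`(i, j)` with `i ∈ B`, all in the strip between the horizontal lines at heights `j` and `j + 1`. -/
def strip (j : ℤ) (A B : Finset ℤ) : Finset UnitTriangle :=
  A.image (fun i => (i, j, true)) ∪ B.image (fun i => (i, j, false))

lemma mem_strip_up {j x y : ℤ} {A B : Finset ℤ} :
    ((x, y, true) : UnitTriangle) ∈ strip j A B ↔ x ∈ A ∧ y = j := by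
  simp [strip]; grind

lemma mem_strip_down {j x y : ℤ} {A B : Finset ℤ} :
    ((x, y, false) : UnitTriangle) ∈ strip j A B ↔ x ∈ B ∧ y = j := by
  simp [strip]; grind

/-- The condition under which `strip j A B` can be tiled. The triangles of a strip, from left to right,
are `…, up i, down i, up (i + 1), down (i + 1), …`, and each of them shares a side with the next.
Matching from the left succeeds if and only if the down-pointing triangles before `up t` are at most
as many as the up-pointing ones up to and including `up t`, and these are at most as many as the
down-pointing ones up to and including `down t`. -/
def Balanced (A B : Finset ℤ) : Prop :=
  ∀ t, countLT B t ≤ countLT A (t + 1) ∧ countLT A (t + 1) ≤ countLT B (t + 1)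

lemma strip_sdiff (j x y : ℤ) (A B : Finset ℤ) :
    strip j A B \ {(x, j, true), (y, j, false)} = strip j (A.erase x) (B.erase y) := by
  ext ⟨p, q, s⟩
  cases s <;> simp [mem_strip_up, mem_strip_down] <;> tauto

open Classical in
/-- A strip has at most one tiling: what happens at its leftmost triangle is forced. -/
lemma tilingCount_strip (j : ℤ) (A B : Finset ℤ) :
    tilingCount (strip j A B) = if Balanced A B then 1 else 0 := by
  induction hn : A.card + B.card using Nat.strong_induction_on generalizing A B with
  | _ n ih =>
  by_cases hne : (A ∪ B).Nonempty
  swap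
  · rw [Finset.not_nonempty_iff_eq_empty, Finset.union_eq_empty] at hne
    obtain ⟨rfl, rfl⟩ := hne
    rw [if_pos (by simp [Balanced, countLT])]
    exact tilingCount_empty
  obtain ⟨i, hi, hmin⟩ : ∃ i ∈ A ∪ B, ∀ x ∈ A ∪ B, i ≤ x :=
    ⟨_, Finset.min'_mem _ hne, fun x hx => Finset.min'_le _ x hx⟩
  have hA : ∀ x ∈ A, i ≤ x := fun x hx => hmin x (by simp [hx])
  have hB : ∀ x ∈ B, i ≤ x := fun x hx => hmin x (by simp [hx])
  have hA0 := countLT_eq_zero hA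
  have hB0 := countLT_eq_zero hB
  by_cases hiA : i ∈ A
  · by_cases hiB : i ∈ B
    · have hlt : (A.erase i).card + (B.erase i).card < n := by
        have := Finset.card_erase_lt_of_mem hiA
        have := Finset.card_erase_lt_of_mem hiB
        omega
      rw [tilingCount_forced (t := (i, j, true)) (u := (i, j, false)), strip_sdiff,
        ih _ hlt _ _ rfl]
      · congr 1
        refine propext (forall_congr' fun t => ?_)
        have h1 := countLT_erase hiA (t + 1)
        have h2 := countLT_erase hiB (t + 1)
        have h3 := countLT_erase hiB t
        have h4 := countLT_succ A t
        rcases lt_trichotomy t i with h | rfl | h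
        · rw [if_neg (by omega)] at h1 h2 h3; omega
        · rw [if_pos (by omega)] at h1 h2; rw [if_neg (by omega)] at h3; omega
        · rw [if_pos (by omega)] at h1 h2 h3; omega
      · simp [mem_strip_up, hiA]
      · simp [mem_strip_down, hiB]
      · simp [isLozenge_up_down]
      · rintro ⟨x, y, s⟩ hv hL
        cases s
        · rw [isLozenge_up_down] at hL
          obtain ⟨hx, rfl⟩ := mem_strip_down.1 hv
          have := hB x hx
          simp; omega
        · exact absurd hL (not_isLozenge_same _ _ _ _ _)
    · rw [tilingCount_eq_zero (t := (i, j, true)), if_neg]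
      · intro h
        have := (h i).2
        rw [countLT_succ, countLT_succ, if_pos hiA, if_neg hiB] at this
        omega
      · simp [mem_strip_up, hiA]
      · rintro ⟨x, y, s⟩ hv hL
        cases s
        · rw [isLozenge_up_down] at hL
          obtain ⟨hx, rfl⟩ := mem_strip_down.1 hv
          have := hB x hx
          have : x = i := by omega
          exact hiB (this ▸ hx)
        · exact absurd hL (not_isLozenge_same _ _ _ _ _)
  · have hiB : i ∈ B := by simpa [hiA] using hi
    by_cases hiA' : i + 1 ∈ A
    · have hlt : (A.erase (i + 1)).card + (B.erase i).card < n := by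
        have := Finset.card_erase_lt_of_mem hiA'
        have := Finset.card_erase_lt_of_mem hiB
        omega
      rw [tilingCount_forced (t := (i, j, false)) (u := (i + 1, j, true)), Finset.pair_comm,
        strip_sdiff, ih _ hlt _ _ rfl]
      · congr 1
        refine propext (forall_congr' fun t => ?_)
        have h1 := countLT_erase hiA' (t + 1)
        have h2 := countLT_erase hiB (t + 1)
        have h3 := countLT_erase hiB t
        have h4 := countLT_succ A t
        rcases lt_trichotomy t i with h | rfl | h
        · rw [if_neg (by omega)] at h1 h2 h3; omega
        · rw [if_neg hiA] at h4
          rw [if_pos (by omega)] at h2; rw [if_neg (by omega)] at h1 h3; omega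
        · rw [if_pos (by omega)] at h1 h2 h3; omega
      · simp [mem_strip_down, hiB]
      · simp [mem_strip_up, hiA']
      · rw [Finset.pair_comm]; simp [isLozenge_up_down]
      · rintro ⟨x, y, s⟩ hv hL
        cases s
        · exact absurd hL (not_isLozenge_same _ _ _ _ _)
        · rw [Finset.pair_comm, isLozenge_up_down] at hL
          obtain ⟨hx, rfl⟩ := mem_strip_up.1 hv
          have := hA x hx
          have : x ≠ i := fun h => hiA (h ▸ hx)
          simp; omega
    · rw [tilingCount_eq_zero (t := (i, j, false)), if_neg]
      · intro h
        have := (h (i + 1)).1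
        rw [countLT_succ, countLT_succ, countLT_succ, if_neg hiA, if_neg hiA', if_pos hiB] at this
        omega
      · simp [mem_strip_down, hiB]
      · rintro ⟨x, y, s⟩ hv hL
        cases s
        · exact absurd hL (not_isLozenge_same _ _ _ _ _)
        · rw [Finset.pair_comm, isLozenge_up_down] at hL
          obtain ⟨hx, rfl⟩ := mem_strip_up.1 hv
          have := hA x hx
          have : x ≠ i := fun h => hiA (h ▸ hx)
          exact hiA' ((show x = i + 1 by omega) ▸ hx)

/-- The finite sets `T` and `S` interlace. Together with `S.card = T.card + 1` this says that
`s₀ < t₀ ≤ s₁ < t₁ ≤ ⋯ < tₙ₋₁ ≤ sₙ` for the elements in increasing order, see `interlaces_image_iff`;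
counting functions are easier to compare with the tiling condition of a strip. -/
def Interlaces (T S : Finset ℤ) : Prop :=
  ∀ t, countLT T (t + 1) ≤ countLT S t ∧ countLT S t ≤ countLT T t + 1

/-- A full strip of a trapezoid, with dents `T` on the lower line and `S` on the upper line, can be
tiled if and only if `T` and `S` interlace. -/
lemma balanced_sdiff_iff {u v : ℤ} (huv : u ≤ v) {S T : Finset ℤ} (hT : T ⊆ Finset.Ico u v)
    (hS : S ⊆ Finset.Ico (u - 1) v) :
    Balanced (Finset.Ico u v \ T) (Finset.Ico (u - 1) v \ S) ↔
      S.card = T.card + 1 ∧ Interlaces T S := by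
  have hT' : ∀ t, (countLT (Finset.Ico u v \ T) t : ℤ) + countLT T t = max 0 (min v t - u) := by
    intro t; rw [← countLT_Ico, ← countLT_sdiff hT]; simp
  have hS' : ∀ t, (countLT (Finset.Ico (u - 1) v \ S) t : ℤ) + countLT S t =
      max 0 (min v t - (u - 1)) := by
    intro t; rw [← countLT_Ico, ← countLT_sdiff hS]; simp
  have hTv : ∀ t, v ≤ t → countLT T t = T.card := fun t ht =>
    countLT_eq_card fun x hx => by have := Finset.mem_Ico.1 (hT hx); omega
  have hSv : ∀ t, v ≤ t → countLT S t = S.card := fun t ht =>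
    countLT_eq_card fun x hx => by have := Finset.mem_Ico.1 (hS hx); omega
  have hTu : ∀ t, t ≤ u → countLT T t = 0 := fun t ht =>
    countLT_eq_zero fun x hx => by have := Finset.mem_Ico.1 (hT hx); omega
  have hSu : ∀ t, t ≤ u - 1 → countLT S t = 0 := fun t ht =>
    countLT_eq_zero fun x hx => by have := Finset.mem_Ico.1 (hS hx); omega
  have hSs : ∀ t, countLT S (t + 1) ≤ countLT S t + 1 := fun t => by
    rw [countLT_succ]; split_ifs <;> omega
  constructor
  · intro h
    have hcard : S.card = T.card + 1 := by
      have := h v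
      have := hT' (v + 1); have := hS' v; have := hS' (v + 1)
      have := hTv (v + 1) (by omega); have := hSv v le_rfl; have := hSv (v + 1) (by omega)
      omega
    refine ⟨hcard, fun t => ⟨?_, ?_⟩⟩
    · have := h t
      have := hT' (t + 1); have := hS' t
      have := hTv (t + 1); have := hSv t; have := hTu (t + 1)
      omega
    · have := h (t - 1)
      rw [sub_add_cancel] at this
      have := hT' t; have := hS' t
      have := hTv t; have := hSv t; have := hSu t; have := hSs (t - 1)
      rw [sub_add_cancel] at this
      have := hSu (t - 1)
      omega
  · rintro ⟨hcard, h⟩ t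
    have := h t
    have := h (t + 1)
    have := hT' (t + 1); have := hS' t; have := hS' (t + 1)
    have := hTv (t + 1); have := hSv t; have := hSv (t + 1)
    have := hTu (t + 1); have := hSu t; have := hSu (t + 1)
    omega

/-! ### Discrete integration of Vandermonde products -/

/-- The Vandermonde product `∏ (y - x)` over the pairs `x < y` of elements of `S`. -/
def vdm (S : Finset ℤ) : ℤ := ∏ x ∈ S, ∏ y ∈ S.filter (x < ·), (y - x)

lemma vdm_image {n : ℕ} {s : Fin n → ℤ} (hs : StrictMono s) :
    vdm (Finset.univ.image s) = (Matrix.vandermonde s).det := by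
  rw [vdm, Matrix.det_vandermonde, Finset.prod_image (fun _ _ _ _ h => hs.injective h)]
  refine Finset.prod_congr rfl fun i _ => ?_
  have : (Finset.univ.image s).filter (s i < ·) = (Finset.Ioi i).image s := by
    ext x
    simp only [Finset.mem_filter, Finset.mem_image, Finset.mem_univ, true_and, Finset.mem_Ioi]
    constructor
    · rintro ⟨⟨j, rfl⟩, h⟩; exact ⟨j, hs.lt_iff_lt.1 h, rfl⟩
    · rintro ⟨j, h, rfl⟩; exact ⟨⟨j, rfl⟩, hs h⟩
  rw [this, Finset.prod_image (fun _ _ _ _ h => hs.injective h)]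

/-- Subtracting consecutive rows of a matrix with a first column of ones. -/
lemma det_eq_det_consecutive_sub {R : Type*} [CommRing R] {n : ℕ}
    (M : Matrix (Fin (n + 1)) (Fin (n + 1)) R) (hM : ∀ i, M i 0 = 1) :
    M.det = (Matrix.of fun i j : Fin n => M i.succ j.succ - M i.castSucc j.succ).det := by
  let B : Matrix (Fin (n + 1)) (Fin (n + 1)) R :=
    Matrix.of (Fin.cons (M 0) fun i j => M i.succ j - M i.castSucc j)
  have hMB : M.det = B.det := by
    refine Matrix.det_eq_of_forall_row_eq_smul_add_pred (fun _ => 1) (fun j => ?_) (fun i j => ?_)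
    · simp [B]
    · simp [B]
  rw [hMB, Matrix.det_succ_column_zero, Fin.sum_univ_succ, Finset.sum_eq_zero]
  · simp only [B, Matrix.of_apply, Fin.cons_zero, hM, Fin.val_zero, pow_zero, mul_one, one_mul,
      add_zero]
    congr 1
  · intro i _
    simp [B, hM]

lemma descPochhammer_eval_add_one_sub (j : ℕ) (x : ℤ) :
    (descPochhammer ℤ (j + 1)).eval (x + 1) - (descPochhammer ℤ (j + 1)).eval x =
      (j + 1) * (descPochhammer ℤ j).eval x := by
  have := congrArg (Polynomial.eval (x + 1)) (descPochhammer_succ_comp_X_sub_one (R := ℤ) j)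
  simp [Polynomial.eval_comp] at this
  linarith

lemma sum_Ioc_descPochhammer (j : ℕ) {s s' : ℤ} (h : s ≤ s') :
    ∑ x ∈ Finset.Ioc s s', ((j : ℤ) + 1) * (descPochhammer ℤ j).eval x =
      (descPochhammer ℤ (j + 1)).eval (s' + 1) - (descPochhammer ℤ (j + 1)).eval (s + 1) := by
  induction s', h using Int.leInduction with
  | base => simp
  | succ n hn ih =>
    have : Finset.Ioc s (n + 1) = insert (n + 1) (Finset.Ioc s n) := by
      ext; simp only [Finset.mem_Ioc, Finset.mem_insert]; omega
    rw [this, Finset.sum_insert (by simp), ih, ← descPochhammer_eval_add_one_sub]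
    ring

lemma det_vandermonde_eq_descPochhammer {n : ℕ} (v : Fin n → ℤ) :
    (Matrix.vandermonde v).det =
      (Matrix.of fun i j : Fin n => (descPochhammer ℤ j).eval (v i)).det :=
  Matrix.det_eval_matrixOfPolynomials_eq_det_vandermonde v (fun j => descPochhammer ℤ j)
    (fun j => descPochhammer_natDegree ℤ j) (fun j => monic_descPochhammer ℤ j)

/-- The discrete integral of a Vandermonde determinant over interlacing sequences. In the basis of
falling factorials every row can be summed by itself, and the sums telescope. -/
lemma sum_vandermonde_Ioc {n : ℕ} {s : Fin (n + 1) → ℤ} (hs : StrictMono s) :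
    (n.factorial : ℤ) *
      ∑ t ∈ Fintype.piFinset (fun i : Fin n => Finset.Ioc (s i.castSucc) (s i.succ)),
        (Matrix.vandermonde t).det = (Matrix.vandermonde s).det := by
  -- The sum of the falling factorials of degree `j` over `Ioc x y` is a difference of values at
  -- `y + 1` and `x + 1`, whence the shift of `s` by `1`.
  rw [← Matrix.det_vandermonde_add s 1, det_vandermonde_eq_descPochhammer,
    det_eq_det_consecutive_sub _ (by simp)]
  have h1 : (Matrix.of fun i j : Fin n =>
      Matrix.of (fun i j : Fin (n + 1) => (descPochhammer ℤ j).eval (s i + 1)) i.succ j.succ -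
        Matrix.of (fun i j : Fin (n + 1) => (descPochhammer ℤ j).eval (s i + 1))
          i.castSucc j.succ) =
      Matrix.of fun i j : Fin n => ((j : ℤ) + 1) * (∑ x ∈ Finset.Ioc (s i.castSucc) (s i.succ),
        (fun j : Fin n => (descPochhammer ℤ j).eval x)) j := by
    ext i j
    simp only [Matrix.of_apply, Finset.sum_apply, Fin.val_succ]
    rw [← sum_Ioc_descPochhammer j (hs.monotone (Fin.castSucc_lt_succ).le), Finset.mul_sum]
  rw [h1, Matrix.det_mul_row (fun j : Fin n => (j : ℤ) + 1)
    (fun i => ∑ x ∈ Finset.Ioc (s i.castSucc) (s i.succ),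
        (fun j : Fin n => (descPochhammer ℤ j).eval x))]
  congr 1
  · rw [Fin.prod_univ_eq_prod_range (fun j : ℕ => (j : ℤ) + 1) n,
      ← Finset.prod_range_add_one_eq_factorial]
    push_cast
    rfl
  · refine Eq.trans ?_ (MultilinearMap.map_sum_finset
      (Matrix.detRowAlternating (R := ℤ) (n := Fin n)).toMultilinearMap
      (fun _ x => (fun j : Fin n => (descPochhammer ℤ j).eval x))
      (fun i => Finset.Ioc (s i.castSucc) (s i.succ))).symm
    refine Finset.sum_congr rfl fun t _ => ?_
    rw [det_vandermonde_eq_descPochhammer]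
    rfl

lemma countLT_image {n : ℕ} {s : Fin n → ℤ} (hs : StrictMono s) (x : ℤ) :
    countLT (Finset.univ.image s) x = (Finset.univ.filter (fun i => s i < x)).card := by
  rw [countLT, Finset.filter_image, Finset.card_image_of_injective _ hs.injective]

lemma countLT_image_self {n : ℕ} {s : Fin n → ℤ} (hs : StrictMono s) (i : Fin n) :
    countLT (Finset.univ.image s) (s i) = i := by
  rw [countLT_image hs]
  have : Finset.univ.filter (fun j => s j < s i) = Finset.Iio i := by
    ext j; simp [hs.lt_iff_lt]
  rw [this, Fin.card_Iio]

lemma countLT_mono (S : Finset ℤ) {x y : ℤ} (h : x ≤ y) : countLT S x ≤ countLT S y :=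
  Finset.card_le_card fun z hz => by simp only [Finset.mem_filter] at hz ⊢; exact ⟨hz.1, by omega⟩

lemma interlaces_image_iff {n : ℕ} {s : Fin (n + 1) → ℤ} {t : Fin n → ℤ} (hs : StrictMono s)
    (ht : StrictMono t) : Interlaces (Finset.univ.image t) (Finset.univ.image s) ↔
      ∀ i : Fin n, s i.castSucc < t i ∧ t i ≤ s i.succ := by
  constructor
  · intro h i
    constructor
    · by_contra hlt
      have h1 := (h (t i)).1
      rw [countLT_succ, countLT_image_self ht, if_pos (by simp)] at h1
      have h2 := countLT_mono (Finset.univ.image s) (not_lt.1 hlt)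
      rw [countLT_image_self hs] at h2
      simp at h2
      omega
    · by_contra hlt
      have h1 := (h (s i.succ + 1)).2
      rw [countLT_succ, countLT_image_self hs, if_pos (by simp)] at h1
      have h2 := countLT_mono (Finset.univ.image t) (show s i.succ + 1 ≤ t i by omega)
      rw [countLT_image_self ht] at h2
      simp at h1
      omega
  · intro h x
    rw [countLT_image ht, countLT_image ht, countLT_image hs]
    constructor
    · rw [← Finset.card_map Fin.castSuccEmb]
      refine Finset.card_le_card fun j hj => ?_
      obtain ⟨i, hi, rfl⟩ := Finset.mem_map.1 hj
      simp only [Finset.mem_filter, Finset.mem_univ, true_and] at hi ⊢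
      have := (h i).1
      simp only [Fin.coe_castSuccEmb]
      omega
    · rw [← Finset.card_map (Fin.succEmb n)]
      refine (Finset.card_le_card fun j hj => ?_).trans (Finset.card_insert_le 0 _)
      refine Fin.cases (by simp) (fun i hi => ?_) j hj
      simp only [Finset.mem_filter, Finset.mem_univ, true_and] at hi
      have := (h i).2
      refine Finset.mem_insert_of_mem (Finset.mem_map.2 ⟨i, ?_, rfl⟩)
      simp only [Finset.mem_filter, Finset.mem_univ, true_and]
      omega

lemma exists_strictMono_image {n : ℕ} {S : Finset ℤ} (hS : S.card = n) :
    ∃ s : Fin n → ℤ, StrictMono s ∧ Finset.univ.image s = S :=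
  ⟨S.orderEmbOfFin hS, (S.orderEmbOfFin hS).strictMono, S.image_orderEmbOfFin_univ hS⟩

open Classical in
/-- The discrete integral of the Vandermonde product over the sets that interlace with a given
set. -/
lemma sum_vdm_interlaces {n : ℕ} {u v : ℤ} {S : Finset ℤ} (hS : S.card = n + 1)
    (hSuv : S ⊆ Finset.Ico (u - 1) v) :
    (n.factorial : ℤ) *
      ∑ T ∈ (Finset.Ico u v).powerset.filter (fun T => T.card = n ∧ Interlaces T S),
        vdm T = vdm S := by
  obtain ⟨s, hs, rfl⟩ := exists_strictMono_image hS
  rw [vdm_image hs, ← sum_vandermonde_Ioc hs]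
  congr 1
  symm
  have mono : ∀ t ∈ Fintype.piFinset (fun i : Fin n => Finset.Ioc (s i.castSucc) (s i.succ)),
      StrictMono t := by
    intro t ht
    simp only [Fintype.mem_piFinset, Finset.mem_Ioc] at ht
    intro i j hij
    have h1 : s i.succ ≤ s j.castSucc := hs.monotone (by
      rw [Fin.le_def]; simp; exact hij)
    have := ht i; have := ht j
    omega
  refine Finset.sum_bij (fun t _ => Finset.univ.image t) ?_ ?_ ?_ ?_
  · intro t ht
    have hm := mono t ht
    simp only [Fintype.mem_piFinset, Finset.mem_Ioc] at ht
    refine Finset.mem_filter.2 ⟨Finset.mem_powerset.2 fun x hx => ?_, ?_,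
      (interlaces_image_iff hs hm).2 ht⟩
    · obtain ⟨i, -, rfl⟩ := Finset.mem_image.1 hx
      have h1 := Finset.mem_Ico.1 (hSuv (Finset.mem_image_of_mem s (Finset.mem_univ i.castSucc)))
      have h2 := Finset.mem_Ico.1 (hSuv (Finset.mem_image_of_mem s (Finset.mem_univ i.succ)))
      have := ht i
      rw [Finset.mem_Ico]
      omega
    · rw [Finset.card_image_of_injective _ hm.injective, Finset.card_univ, Fintype.card_fin]
  · intro t ht t' ht' h
    have h' : Set.range t = Set.range t' := by
      simpa using congrArg (fun A : Finset ℤ => (A : Set ℤ)) h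
    exact (mono t ht).range_inj (mono t' ht') |>.1 h'
  · intro T hT
    obtain ⟨-, hT, hTS⟩ := Finset.mem_filter.1 hT
    obtain ⟨t, ht, rfl⟩ := exists_strictMono_image hT
    refine ⟨t, ?_, rfl⟩
    simp only [Fintype.mem_piFinset, Finset.mem_Ioc]
    exact (interlaces_image_iff hs ht).1 hTS
  · intro t ht
    exact (vdm_image (mono t ht)).symm

/-! ### Dented trapezoids with cut-off corners -/

lemma countLT_add_card_filter_le (S : Finset ℤ) (y : ℤ) :
    countLT S y + (S.filter (y ≤ ·)).card = S.card := by
  have := Finset.card_filter_add_card_filter_not (s := S) (· < y)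
  simpa [countLT] using this

/-- A block of dents at the left end of a line forces a block of dents, shorter by one, on the line
below it. -/
lemma Interlaces.Ico_subset_left {u v w : ℤ} {S T : Finset ℤ} (h : Interlaces T S)
    (hT : T ⊆ Finset.Ico u v) (hS : Finset.Ico (u - 1) w ⊆ S) : Finset.Ico u w ⊆ T := by
  intro x hx
  by_contra hxT
  rw [Finset.mem_Ico] at hx
  have h1 := (h (x + 1)).2
  rw [countLT_succ T, if_neg hxT] at h1
  have h2 := countLT_sdiff hT x
  have h3 := countLT_Ico u v x
  have h4 := countLT_sdiff hS (x + 1)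
  have h5 := countLT_Ico (u - 1) w (x + 1)
  omega

/-- A block of dents at the right end of a line forces a block of dents, shorter by one, on the line
below it. -/
lemma Interlaces.Ico_subset_right {u v w : ℤ} {S T : Finset ℤ} (h : Interlaces T S)
    (hcard : S.card = T.card + 1) (hT : T ⊆ Finset.Ico u v) (hS : Finset.Ico w v ⊆ S) :
    Finset.Ico (w + 1) v ⊆ T := by
  intro x hx
  by_contra hxT
  rw [Finset.mem_Ico] at hx
  have h1 := (h (x - 1)).1
  rw [sub_add_cancel] at h1
  have h2 := countLT_add_card_filter_le T x
  have h3 := countLT_add_card_filter_le S (x - 1)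
  have h4 : (T.filter (x ≤ ·)).card ≤ (Finset.Ico (x + 1) v).card := by
    refine Finset.card_le_card fun y hy => ?_
    obtain ⟨hy, hxy⟩ := Finset.mem_filter.1 hy
    have := Finset.mem_Ico.1 (hT hy)
    have : x ≠ y := fun h => hxT (h ▸ hy)
    rw [Finset.mem_Ico]; omega
  have h5 : (Finset.Ico (x - 1) v).card ≤ (S.filter (x - 1 ≤ ·)).card := by
    refine Finset.card_le_card fun y hy => ?_
    rw [Finset.mem_Ico] at hy
    exact Finset.mem_filter.2 ⟨hS (Finset.mem_Ico.2 (by omega)), hy.1⟩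
  rw [Int.card_Ico] at h4 h5
  omega

/-- The part below height `h` of a hexagon with bottom side from `(0, 0)` to `(n, 0)`, lower left
side of length `p` and lower right side of length `q`. -/
noncomputable def lowerPart (n p q h : ℕ) : Finset UnitTriangle :=
  (Finset.Icc (-(p : ℤ)) n ×ˢ Finset.Icc (0 : ℤ) h ×ˢ (Finset.univ : Finset Bool)).filter
    fun t => ∀ x ∈ vertices t, (0 ≤ x.2 ∧ x.2 ≤ h) ∧ (-(p : ℤ) ≤ x.1 ∧ x.1 ≤ n) ∧
      (0 ≤ x.1 + x.2 ∧ x.1 + x.2 ≤ n + q)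

lemma mem_lowerPart_up {n p q h : ℕ} {i j : ℤ} : ((i, j, true) : UnitTriangle) ∈ lowerPart n p q h ↔
    (0 ≤ j ∧ j < h) ∧ (-(p : ℤ) ≤ i ∧ i < n) ∧ (0 ≤ i + j ∧ i + j < n + q) := by
  rw [lowerPart, Finset.mem_filter]
  simp [vertices]
  omega

lemma mem_lowerPart_down {n p q h : ℕ} {i j : ℤ} :
    ((i, j, false) : UnitTriangle) ∈ lowerPart n p q h ↔
    (0 ≤ j ∧ j < h) ∧ (-(p : ℤ) ≤ i ∧ i < n) ∧ (0 ≤ i + j + 1 ∧ i + j + 2 ≤ n + q) := by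
  rw [lowerPart, Finset.mem_filter]
  simp [vertices]
  omega

/-- The positions (abscissas of the left endpoints) of the unit segments of the line at height `h`
in the hexagon of `lowerPart n p q`. -/
noncomputable def lineIco (n p q h : ℕ) : Finset ℤ :=
  Finset.Ico (-min (p : ℤ) h) (min (n : ℤ) (n + q - h))

lemma mem_lineIco {n p q h : ℕ} {x : ℤ} : x ∈ lineIco n p q h ↔
    (-(p : ℤ) ≤ x ∧ -(h : ℤ) ≤ x) ∧ (x < n ∧ x < n + q - h) := by
  rw [lineIco, Finset.mem_Ico]; omega

/-- The positions by which the line at height `h` of the trapezoid with bottom side of length `n`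
exceeds that of the hexagon of `lowerPart n p q`. Cutting off the corners of the trapezoid has the
same effect as dents in these positions. Either block is empty when its corner is not cut off. -/
noncomputable def sideDents (n p q h : ℕ) : Finset ℤ :=
  Finset.Ico (-(h : ℤ)) (-p) ∪ Finset.Ico ((n : ℤ) + q - h) n

lemma mem_sideDents {n p q h : ℕ} {x : ℤ} : x ∈ sideDents n p q h ↔
    (-(h : ℤ) ≤ x ∧ x < -p) ∨ ((n : ℤ) + q - h ≤ x ∧ x < n) := by
  simp [sideDents]

lemma lineIco_sdiff (n p q h : ℕ) (S : Finset ℤ) :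
    lineIco n p q h \ S = Finset.Ico (-(h : ℤ)) n \ (S ∪ sideDents n p q h) := by
  ext x
  simp only [Finset.mem_sdiff, Finset.mem_union, mem_lineIco, mem_sideDents, Finset.mem_Ico]
  by_cases hx : x ∈ S <;> simp [hx]; omega

lemma lineIco_disjoint_sideDents (n p q h : ℕ) :
    Disjoint (lineIco n p q h) (sideDents n p q h) := by
  rw [Finset.disjoint_left]
  intro x; rw [mem_lineIco, mem_sideDents]; omega

lemma union_sideDents_subset {n p q h : ℕ} {S : Finset ℤ}
    (hS : S ⊆ lineIco n p q h) : S ∪ sideDents n p q h ⊆ Finset.Ico (-(h : ℤ)) n := by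
  intro x hx
  rw [Finset.mem_Ico]
  rcases Finset.mem_union.1 hx with hx | hx
  · have := mem_lineIco.1 (hS hx); omega
  · have := mem_sideDents.1 hx; omega

lemma lowerPart_zero (n p q : ℕ) : lowerPart n p q 0 = ∅ := by
  refine Finset.eq_empty_of_forall_notMem ?_
  rintro ⟨i, j, s⟩ h
  cases s
  · rw [mem_lowerPart_down] at h; omega
  · rw [mem_lowerPart_up] at h; omega

open Classical in
/-- Cutting off the top strip. At `h = 0` no lozenge can cross the line, since it is the bottom
side. -/
lemma tilingCount_lowerPart_succ (n p q h : ℕ) (S : Finset ℤ) :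
    tilingCount (lowerPart n p q (h + 1) \ S.image (fun i => downOn (i, (h : ℤ) + 1))) =
      ∑ T ∈ (if h = 0 then ∅ else lineIco n p q h).powerset,
        tilingCount (lowerPart n p q h \ T.image (fun i => downOn (i, (h : ℤ)))) *
        if Balanced (Finset.Ico (-(h : ℤ)) n \ (T ∪ sideDents n p q h))
            (Finset.Ico (-(h : ℤ) - 1) n \ (S ∪ sideDents n p q (h + 1))) then 1 else 0 := by
  rw [tilingCount_cut _ (h : ℤ) (if h = 0 then ∅ else lineIco n p q h)]
  · refine Finset.sum_congr rfl fun T _ => ?_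
    rw [← tilingCount_strip h, ← lineIco_sdiff]
    have := lineIco_sdiff n p q (h + 1) S
    push_cast at this
    rw [show -(h : ℤ) - 1 = -(h + 1) by ring, ← this]
    congr 2
    · congr 1
      ext ⟨x, y, s⟩
      cases s
      · simp only [Finset.mem_filter, Finset.mem_sdiff, mem_lowerPart_down, Finset.mem_image,
          downOn, Prod.mk.injEq]
        push_cast
        constructor
        · rintro ⟨⟨h1, h2⟩, h3⟩; omega
        · rintro h1; refine ⟨⟨by omega, ?_⟩, by omega⟩
          rintro ⟨i, hi, h2⟩; omega
      · simp only [Finset.mem_filter, Finset.mem_sdiff, mem_lowerPart_up, Finset.mem_image, downOn,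
          Prod.mk.injEq]
        simp
        omega
    · ext ⟨x, y, s⟩
      cases s
      · simp only [Finset.mem_filter, Finset.mem_sdiff, mem_lowerPart_down, Finset.mem_image,
          downOn, Prod.mk.injEq, mem_strip_down, mem_lineIco, upOn]
        push_cast
        constructor
        · rintro ⟨⟨⟨h1, h2⟩, h3⟩, h4⟩
          have hy : y = h := by omega
          refine ⟨⟨by omega, fun hx => h2 ⟨hx, by simp [hy]⟩⟩, hy⟩
        · rintro ⟨⟨h1, h2⟩, rfl⟩
          refine ⟨⟨⟨by omega, ?_⟩, by omega⟩, by simp⟩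
          exact fun h3 => h2 h3.1
      · simp only [Finset.mem_filter, Finset.mem_sdiff, mem_lowerPart_up, Finset.mem_image, downOn,
          Prod.mk.injEq, mem_strip_up, mem_lineIco, upOn]
        push_cast
        constructor
        · rintro ⟨⟨⟨h1, h2⟩, h3⟩, h4⟩
          have hy : y = h := by omega
          refine ⟨⟨by omega, fun hx => h4 ⟨hx, by simp [hy]⟩⟩, hy⟩
        · rintro ⟨⟨h1, h2⟩, rfl⟩
          refine ⟨⟨⟨by omega, by simp⟩, by omega⟩, ?_⟩
          exact fun h3 => h2 h3.1
  · intro i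
    simp only [upOn, downOn, Finset.mem_sdiff, mem_lowerPart_up, mem_lowerPart_down,
      Finset.mem_image, Prod.mk.injEq]
    push_cast
    split_ifs with h0
    · simp; omega
    · rw [mem_lineIco]
      constructor
      · intro h1
        refine ⟨⟨by omega, by simp⟩, ⟨by omega, ?_⟩⟩
        rintro ⟨x, -, h2⟩; omega
      · rintro ⟨⟨h1, -⟩, ⟨h2, -⟩⟩; omega

open Classical in
/-- The number of tilings of a dented trapezoid with cut-off corners: the Cohn–Larsen–Propp
formula. The hypothesis `h0` excludes dents on the bottom side, where there is nothing to remove. -/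
lemma tilingCount_lowerPart {n p q h : ℕ} (hpq : h ≤ p + q) {S : Finset ℤ}
    (hS : S ⊆ lineIco n p q h) (h0 : h = 0 → S = ∅) :
    (hyperfactorial h : ℤ) *
        tilingCount (lowerPart n p q h \ S.image (fun i => downOn (i, (h : ℤ)))) =
      if (S ∪ sideDents n p q h).card = h then vdm (S ∪ sideDents n p q h) else 0 := by
  induction h generalizing S with
  | zero =>
    rw [h0 rfl, lowerPart_zero]
    have : sideDents n p q 0 = ∅ := by
      ext x; simp [mem_sideDents]; omega
    simp [this, tilingCount_empty, hyperfactorial, vdm]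
  | succ h ih =>
    have hS' : S ∪ sideDents n p q (h + 1) ⊆ Finset.Ico (-(h : ℤ) - 1) n := by
      refine (union_sideDents_subset hS).trans_eq ?_
      push_cast; congr 1; ring
    push_cast
    rw [tilingCount_lowerPart_succ]
    rw [hyperfactorial, Finset.prod_range_succ, ← hyperfactorial]
    push_cast
    rw [mul_comm (hyperfactorial h : ℤ), mul_assoc, Finset.mul_sum]
    -- By induction and the tiling condition of a strip, both factors of a summand are explicit. The
    -- summands with `T ≠ ∅` that are added for `h = 0` vanish.
    have step1 : ∑ T ∈ (if h = 0 then ∅ else lineIco n p q h).powerset, (hyperfactorial h : ℤ) *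
        (tilingCount (lowerPart n p q h \ T.image (fun i => downOn (i, (h : ℤ)))) *
        if Balanced (Finset.Ico (-(h : ℤ)) n \ (T ∪ sideDents n p q h))
            (Finset.Ico (-(h : ℤ) - 1) n \ (S ∪ sideDents n p q (h + 1))) then 1 else 0) =
        ∑ T ∈ (lineIco n p q h).powerset, if (T ∪ sideDents n p q h).card = h ∧
          (S ∪ sideDents n p q (h + 1)).card = h + 1 ∧
            Interlaces (T ∪ sideDents n p q h) (S ∪ sideDents n p q (h + 1)) then
              vdm (T ∪ sideDents n p q h) else 0 := by
      refine Finset.sum_subset_zero_on_sdiff ?_ ?_ ?_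
      · refine Finset.powerset_mono.2 ?_
        split_ifs <;> simp
      · intro T hT
        rw [if_neg]
        rintro ⟨hT', -⟩
        obtain ⟨h1, h2⟩ := Finset.mem_sdiff.1 hT
        split_ifs at h2 with hh
        · subst hh
          rw [Finset.card_eq_zero, Finset.union_eq_empty] at hT'
          simp [hT'.1] at h2
        · exact h2 h1
      · intro T hT
        have hT1 : T ⊆ lineIco n p q h := (Finset.mem_powerset.1 hT).trans (by split_ifs <;> simp)
        rw [← mul_assoc, ih (by omega) hT1 (by
          rintro rfl; simpa using hT),
          balanced_sdiff_iff (by omega) (union_sideDents_subset hT1) hS']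
        by_cases h1 : (T ∪ sideDents n p q h).card = h
        · simp [h1]
        · simp [h1]
    rw [step1]
    split_ifs with hc
    · rw [← sum_vdm_interlaces hc hS', ← Finset.sum_filter]
      congr 1
      refine Finset.sum_bij (fun T _ => T ∪ sideDents n p q h) ?_ ?_ ?_ (fun _ _ => rfl)
      · intro T hT
        obtain ⟨hT, h1, -, h2⟩ := Finset.mem_filter.1 hT
        exact Finset.mem_filter.2 ⟨Finset.mem_powerset.2
          (union_sideDents_subset (Finset.mem_powerset.1 hT)), h1, h2⟩
      · intro T hT T' hT' hTT
        have key : ∀ T ∈ (lineIco n p q h).powerset,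
            (T ∪ sideDents n p q h) \ sideDents n p q h = T := by
          intro T hT
          rw [Finset.union_sdiff_right, Finset.sdiff_eq_self_of_disjoint]
          exact (lineIco_disjoint_sideDents n p q h).mono_left (Finset.mem_powerset.1 hT)
        rw [← key T (Finset.mem_filter.1 hT).1, ← key T' (Finset.mem_filter.1 hT').1, hTT]
      · intro T hT
        obtain ⟨hT, h1, h2⟩ := Finset.mem_filter.1 hT
        rw [Finset.mem_powerset] at hT
        -- Every set that interlaces with `S` and its corner blocks contains the corner blocks of
        -- the line below, so summing over dents in the hexagon or in the trapezoid is the same.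
        have hsub : sideDents n p q h ⊆ T := by
          refine Finset.union_subset ?_ ?_
          · refine h2.Ico_subset_left hT fun x hx => Finset.mem_union_right _ ?_
            rw [mem_sideDents]; rw [Finset.mem_Ico] at hx; push_cast; omega
          · have := h2.Ico_subset_right (w := (n : ℤ) + q - h - 1) (by rw [hc, h1]) hT (by
              intro x hx; refine Finset.mem_union_right _ ?_
              rw [mem_sideDents]; rw [Finset.mem_Ico] at hx; push_cast; omega)
            rwa [sub_add_cancel] at this
        have hT' : T \ sideDents n p q h ∪ sideDents n p q h = T :=
          Finset.sdiff_union_of_subset hsub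
        refine ⟨T \ sideDents n p q h, Finset.mem_filter.2 ⟨Finset.mem_powerset.2 fun x hx => ?_,
          ?_⟩, hT'⟩
        · obtain ⟨hx, hx'⟩ := Finset.mem_sdiff.1 hx
          have := Finset.mem_Ico.1 (hT hx)
          rw [mem_sideDents] at hx'
          rw [mem_lineIco]; omega
        · rw [hT']
          exact ⟨h1, hc, h2⟩
    · simp [hc]

/-! ### Rotation of the lattice -/

lemma mem_image_upOn {x y z : ℤ} {S : Finset ℤ} : ((x, y, true) : UnitTriangle) ∈
    S.image (fun i => upOn (i, z)) ↔ x ∈ S ∧ y = z := by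
  simp only [Finset.mem_image, upOn, Prod.mk.injEq]
  constructor
  · rintro ⟨i, hi, rfl, rfl, -⟩; exact ⟨hi, rfl⟩
  · rintro ⟨hx, rfl⟩; exact ⟨x, hx, rfl, rfl, trivial⟩

lemma mem_image_downOn {x y z : ℤ} {S : Finset ℤ} : ((x, y, false) : UnitTriangle) ∈
    S.image (fun i => downOn (i, z)) ↔ x ∈ S ∧ y = z - 1 := by
  simp only [Finset.mem_image, downOn, Prod.mk.injEq]
  constructor
  · rintro ⟨i, hi, rfl, rfl, -⟩; exact ⟨hi, rfl⟩
  · rintro ⟨hx, rfl⟩; exact ⟨x, hx, rfl, rfl, trivial⟩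

lemma notMem_image_upOn {x y z : ℤ} {S : Finset ℤ} : ((x, y, false) : UnitTriangle) ∉
    S.image (fun i => upOn (i, z)) := by simp [upOn]

lemma notMem_image_downOn {x y z : ℤ} {S : Finset ℤ} : ((x, y, true) : UnitTriangle) ∉
    S.image (fun i => downOn (i, z)) := by simp [downOn]

/-- The rotation by `180°` that sends the corner `(x, y)` of the lattice to the origin. -/
def rotation (x y : ℤ) : UnitTriangle ≃ UnitTriangle where
  toFun t := (x - 1 - t.1, y - 1 - t.2.1, !t.2.2)
  invFun t := (x - 1 - t.1, y - 1 - t.2.1, !t.2.2)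
  left_inv t := by simp
  right_inv t := by simp

lemma rotation_apply (x y : ℤ) (t : UnitTriangle) :
    rotation x y t = (x - 1 - t.1, y - 1 - t.2.1, !t.2.2) := rfl

lemma rotation_rotation (x y : ℤ) (t : UnitTriangle) : rotation x y (rotation x y t) = t :=
  (rotation x y).left_inv t

lemma mem_map_rotation {x y : ℤ} {R : Finset UnitTriangle} {t : UnitTriangle} :
    t ∈ R.map (rotation x y).toEmbedding ↔ rotation x y t ∈ R := by
  rw [Finset.mem_map]
  constructor
  · rintro ⟨s, hs, rfl⟩
    rwa [Equiv.coe_toEmbedding, rotation_rotation]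
  · exact fun h => ⟨_, h, rotation_rotation x y t⟩

lemma isLozenge_map_rotation (x y : ℤ) (P : Finset UnitTriangle) :
    IsLozenge (P.map (rotation x y).toEmbedding) ↔ IsLozenge P := by
  have key : ∀ P : Finset UnitTriangle, IsLozenge P →
      IsLozenge (P.map (rotation x y).toEmbedding) := by
    intro P hP
    obtain ⟨i, j, rfl | rfl | rfl⟩ := (isLozenge_iff P).1 hP <;>
    · simp only [Finset.map_insert, Finset.map_singleton, Equiv.coe_toEmbedding, rotation_apply,
        Bool.not_true, Bool.not_false]
      rw [Finset.pair_comm, isLozenge_up_down]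
      omega
  refine ⟨fun h => ?_, key P⟩
  have := key _ h
  convert this
  ext t
  rw [mem_map_rotation, mem_map_rotation, rotation_rotation]

/-! ### Vandermonde products of reflected sets and of unions -/

lemma vdm_image_sub (e : ℤ) (S : Finset ℤ) : vdm (S.image (fun x => e - x)) = vdm S := by
  have inj : Function.Injective (fun x : ℤ => e - x) := fun x y h => by simpa using h
  rw [vdm, Finset.prod_image inj.injOn]
  simp only [Finset.filter_image, Finset.prod_image inj.injOn]
  rw [vdm, Finset.prod_comm' (t' := S) (s' := fun x => S.filter (x < ·))]
  · refine Finset.prod_congr rfl fun x _ => Finset.prod_congr rfl fun y _ => by ring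
  · intro x y
    simp only [Finset.mem_filter]
    constructor
    · rintro ⟨h1, h2, h3⟩; exact ⟨⟨h1, by omega⟩, h2⟩
    · rintro ⟨⟨h1, h2⟩, h3⟩; exact ⟨h1, h3, by omega⟩

/-- The product of the distances from `x` to the elements of `B`. -/
def distProd (B : Finset ℤ) (x : ℤ) : ℤ := ∏ y ∈ B, |y - x|

lemma distProd_pos {B : Finset ℤ} {x : ℤ} (h : x ∉ B) : 0 < distProd B x :=
  Finset.prod_pos fun y hy => abs_pos.2 fun h' => h (by rwa [show x = y by omega])

lemma vdm_insert {S : Finset ℤ} {a : ℤ} (ha : a ∉ S) :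
    vdm (insert a S) = vdm S * distProd S a := by
  have h1 : ∀ x ∈ S, ∏ y ∈ (insert a S).filter (x < ·), (y - x) =
      (∏ y ∈ S.filter (x < ·), (y - x)) * if x < a then a - x else 1 := by
    intro x hx
    rw [Finset.filter_insert]
    split_ifs with h
    · rw [Finset.prod_insert (by simp [ha]), mul_comm]
    · rw [mul_one]
  have h2 : (insert a S).filter (a < ·) = S.filter (a < ·) := by
    rw [Finset.filter_insert, if_neg (lt_irrefl a)]
  rw [vdm, Finset.prod_insert ha, Finset.prod_congr rfl h1, Finset.prod_mul_distrib, ← vdm, h2,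
    mul_comm, mul_assoc]
  congr 1
  rw [Finset.prod_filter, ← Finset.prod_mul_distrib, distProd]
  refine Finset.prod_congr rfl fun x hx => ?_
  have : x ≠ a := fun h => ha (h ▸ hx)
  rcases lt_or_gt_of_ne this with h | h
  · rw [if_pos h, if_neg (by omega), abs_of_neg (by omega)]; ring
  · rw [if_neg (by omega), if_pos h, abs_of_pos (by omega)]; ring

lemma vdm_union {S B : Finset ℤ} (h : Disjoint S B) :
    vdm (S ∪ B) = vdm S * vdm B * ∏ x ∈ S, distProd B x := by
  induction S using Finset.induction_on with
  | empty => simp [vdm]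
  | insert a S ha ih =>
    rw [Finset.disjoint_insert_left] at h
    have h3 : distProd (S ∪ B) a = distProd S a * distProd B a := Finset.prod_union h.2
    rw [Finset.insert_union, vdm_insert (by simp [ha, h.1]), ih h.2, Finset.prod_insert ha,
      vdm_insert ha, h3]
    ring

/-! ### Tilings of a holed hexagon -/

/-- The hexagon without the up-pointing triangles with positions in `X` and the down-pointing
triangles with positions in `Y` on the line at height `l`; a position is the abscissa of the left
endpoint of a unit segment. -/
noncomputable def holedHexagon (a b c k l : ℕ) (X Y : Finset ℤ) : Finset UnitTriangle :=
  hexagon a b c k \ (X.image (fun i => upOn (i, (l : ℤ))) ∪ Y.image (fun i => downOn (i, (l : ℤ))))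

lemma mem_hexagon_up {a b c k : ℕ} {i j : ℤ} : ((i, j, true) : UnitTriangle) ∈ hexagon a b c k ↔
    (0 ≤ j ∧ j < b + c + k) ∧ (-(b : ℤ) ≤ i ∧ i < a + k) ∧ (0 ≤ i + j ∧ i + j < a + k + c) := by
  rw [hexagon, Finset.mem_filter]
  simp [vertices, InHexagon]
  omega

lemma mem_hexagon_down {a b c k : ℕ} {i j : ℤ} : ((i, j, false) : UnitTriangle) ∈ hexagon a b c k ↔
    (0 ≤ j ∧ j < b + c + k) ∧ (-(b : ℤ) ≤ i ∧ i < a + k) ∧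
      (0 ≤ i + j + 1 ∧ i + j + 2 ≤ a + k + c) := by
  rw [hexagon, Finset.mem_filter]
  simp [vertices, InHexagon]
  omega

/-- The analogue of `sideDents` for the part of the hexagon above the line at height `h`, seen as a
trapezoid with cut-off corners that hangs from the top side. -/
noncomputable def upperSideDents (n p q h : ℕ) : Finset ℤ :=
  Finset.Ico (-(p : ℤ)) (-h) ∪ Finset.Ico (n : ℤ) (n + q - h)

lemma mem_upperSideDents {n p q h : ℕ} {x : ℤ} : x ∈ upperSideDents n p q h ↔
    (-(p : ℤ) ≤ x ∧ x < -h) ∨ ((n : ℤ) ≤ x ∧ x < n + q - h) := by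
  simp [upperSideDents]

lemma mem_image_sub {e x : ℤ} {S : Finset ℤ} : x ∈ S.image (fun y => e - y) ↔ e - x ∈ S := by
  rw [Finset.mem_image]
  constructor
  · rintro ⟨y, hy, rfl⟩; simpa using hy
  · exact fun h => ⟨_, h, by ring⟩

lemma card_image_sub (e : ℤ) (S : Finset ℤ) : (S.image (fun y => e - y)).card = S.card :=
  Finset.card_image_of_injective _ fun x y h => by simpa using h

/-- The number of tilings of a trapezoid of height `h` with set of dents `S`, multiplied by the
hyperfactorial of `h`. Up- and down-pointing triangles are equally many only if `S.card = h`. -/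
noncomputable def dentWeight (h : ℕ) (S : Finset ℤ) : ℤ := if S.card = h then vdm S else 0

lemma dentWeight_image_sub (h : ℕ) (e : ℤ) (S : Finset ℤ) :
    dentWeight h (S.image (fun y => e - y)) = dentWeight h S := by
  rw [dentWeight, dentWeight, card_image_sub, vdm_image_sub]

/-- The tiling count of the part of a holed hexagon above its line. Turned by `180°`, this part is
the lower part of another hexagon. -/
lemma tilingCount_upperPart {a b c k l l' : ℕ} (hl : l + l' = b + c) {S : Finset ℤ}
    (hS : S ⊆ lineIco (a + k) b c l) (h0 : l' + k = 0 → S = ∅) :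
    (hyperfactorial (l' + k) : ℤ) * 
      tilingCount ((hexagon a b c k).filter (fun t => ¬ t.2.1 < (l : ℤ)) \
        S.image (fun i => upOn (i, (l : ℤ)))) =
      dentWeight (l' + k) (S ∪ upperSideDents (a + k) b c l) := by
  have hS' : S.image (fun x => (a : ℤ) - b - 1 - x) ⊆ lineIco a (b + k) (c + k) (l' + k) := by
    intro x hx
    have := mem_lineIco.1 (hS (mem_image_sub.1 hx))
    rw [mem_lineIco]; push_cast at this ⊢; omega
  have h1 : (hexagon a b c k).filter (fun t => ¬ t.2.1 < (l : ℤ)) \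
      S.image (fun i => upOn (i, (l : ℤ))) =
      (lowerPart a (b + k) (c + k) (l' + k) \ (S.image (fun x => (a : ℤ) - b - 1 - x)).image
        (fun i => downOn (i, ((l' + k : ℕ) : ℤ)))).map
          (rotation ((a : ℤ) - b) (b + c + k)).toEmbedding := by
    ext ⟨x, y, s⟩
    rw [mem_map_rotation, rotation_apply]
    cases s
    · simp only [Finset.mem_filter, Finset.mem_sdiff, mem_hexagon_down, mem_lowerPart_up,
        Finset.mem_image, Bool.not_false, upOn, downOn, Prod.mk.injEq]
      push_cast
      simp
      omega
    · simp only [Finset.mem_filter, Finset.mem_sdiff, mem_hexagon_up, mem_lowerPart_down,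
        Bool.not_true, mem_image_upOn, mem_image_downOn, mem_image_sub, sub_sub_cancel]
      push_cast
      by_cases hx : x ∈ S
      · simp only [hx, true_and]; omega
      · simp only [hx, false_and, not_false_eq_true, and_true]; omega
  rw [h1, tilingCount_map _ (isLozenge_map_rotation _ _),
    tilingCount_lowerPart (by omega) hS' (fun h => by rw [h0 h]; rfl)]
  have h2 : S.image (fun x => (a : ℤ) - b - 1 - x) ∪ sideDents a (b + k) (c + k) (l' + k) =
      (S ∪ upperSideDents (a + k) b c l).image (fun x => (a : ℤ) - b - 1 - x) := by
    rw [Finset.image_union]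
    congr 1
    ext x
    rw [mem_image_sub, mem_sideDents, mem_upperSideDents]
    push_cast
    omega
  rw [h2]
  exact dentWeight_image_sub (l' + k) _ _

lemma tilingCount_lowerPart_hexagon {a b c k l l' : ℕ} (hl : l + l' = b + c) {S : Finset ℤ}
    (hS : S ⊆ lineIco (a + k) b c l) (h0 : l = 0 → S = ∅) :
    (hyperfactorial l : ℤ) * tilingCount ((hexagon a b c k).filter (fun t => t.2.1 < (l : ℤ)) \
      S.image (fun i => downOn (i, (l : ℤ)))) =
      dentWeight l (S ∪ sideDents (a + k) b c l) := by
  have h1 : (hexagon a b c k).filter (fun t => t.2.1 < (l : ℤ)) = lowerPart (a + k) b c l := by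
    ext ⟨x, y, s⟩
    cases s
    · rw [Finset.mem_filter, mem_hexagon_down, mem_lowerPart_down]; push_cast; omega
    · rw [Finset.mem_filter, mem_hexagon_up, mem_lowerPart_up]; push_cast; omega
  rw [h1, tilingCount_lowerPart (by omega) hS h0, dentWeight]

lemma holedHexagon_filter_lt (a b c k l : ℕ) (X Y Z : Finset ℤ) :
    (holedHexagon a b c k l X Y).filter (fun t => t.2.1 < (l : ℤ)) \
        Z.image (fun i => downOn (i, (l : ℤ))) =
      (hexagon a b c k).filter (fun t => t.2.1 < (l : ℤ)) \
        (Y ∪ Z).image (fun i => downOn (i, (l : ℤ))) := by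
  ext ⟨x, y, s⟩
  cases s
  · simp only [holedHexagon, Finset.mem_filter, Finset.mem_sdiff, Finset.mem_union,
      mem_image_downOn, notMem_image_upOn, false_or]
    tauto
  · simp only [holedHexagon, Finset.mem_filter, Finset.mem_sdiff, Finset.mem_union,
      mem_image_upOn, notMem_image_downOn, or_false, not_false_eq_true, and_true]
    exact ⟨fun h => ⟨h.1.1, h.2⟩, fun h => ⟨⟨h.1, fun h' => by omega⟩, h.2⟩⟩

lemma holedHexagon_filter_not_lt (a b c k l : ℕ) (X Y Z : Finset ℤ) :
    (holedHexagon a b c k l X Y).filter (fun t => ¬ t.2.1 < (l : ℤ)) \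
        Z.image (fun i => upOn (i, (l : ℤ))) =
      (hexagon a b c k).filter (fun t => ¬ t.2.1 < (l : ℤ)) \
        (X ∪ Z).image (fun i => upOn (i, (l : ℤ))) := by
  ext ⟨x, y, s⟩
  cases s
  · simp only [holedHexagon, Finset.mem_filter, Finset.mem_sdiff, Finset.mem_union,
      mem_image_downOn, notMem_image_upOn, false_or, not_false_eq_true, and_true]
    exact ⟨fun h => ⟨h.1.1, h.2⟩, fun h => ⟨⟨h.1, fun h' => by omega⟩, h.2⟩⟩
  · simp only [holedHexagon, Finset.mem_filter, Finset.mem_sdiff, Finset.mem_union,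
      mem_image_upOn, notMem_image_downOn, or_false]
    tauto

/-- The tiling count of a holed hexagon as a sum over the possible sets `Z` of positions of vertical
lozenges that cross the line. -/
lemma tilingCount_holedHexagon {a b c k l l' : ℕ} (hl : l + l' = b + c) {X Y : Finset ℤ}
    (hX : X ⊆ lineIco (a + k) b c l) (hY : Y ⊆ lineIco (a + k) b c l)
    (hX0 : l' + k = 0 → X = ∅) (hY0 : l = 0 → Y = ∅) :
    (hyperfactorial l : ℤ) * hyperfactorial (l' + k) * tilingCount (holedHexagon a b c k l X Y) =
      ∑ Z ∈ (lineIco (a + k) b c l \ (X ∪ Y)).powerset,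
        dentWeight l (Y ∪ Z ∪ sideDents (a + k) b c l) *
          dentWeight (l' + k) (X ∪ Z ∪ upperSideDents (a + k) b c l) := by
  rw [tilingCount_cut _ (l : ℤ)
    (if l = 0 ∨ l' + k = 0 then ∅ else lineIco (a + k) b c l \ (X ∪ Y))]
  · push_cast
    rw [Finset.mul_sum]
    -- No lozenge crosses the bottom or the top side of the hexagon. There the right-hand side has
    -- additional summands, which vanish because they have too many dents.
    refine Finset.sum_subset_zero_on_sdiff ?_ ?_ ?_
    · refine Finset.powerset_mono.2 ?_
      split_ifs <;> simp
    · intro Z hZ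
      obtain ⟨h1, h2⟩ := Finset.mem_sdiff.1 hZ
      split_ifs at h2 with h0
      · have hne : Z ≠ ∅ := by rintro rfl; simp at h2
        rcases h0 with h0 | h0
        · rw [dentWeight, if_neg, zero_mul]
          rw [h0, Finset.card_eq_zero]
          simp [Finset.union_eq_empty, hne]
        · rw [mul_comm, dentWeight, if_neg, zero_mul]
          rw [h0, Finset.card_eq_zero]
          simp [Finset.union_eq_empty, hne]
      · exact absurd h1 h2
    · intro Z hZ
      have hZ0 : l = 0 ∨ l' + k = 0 → Z = ∅ := by
        intro h
        rw [if_pos h] at hZ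
        simpa using hZ
      have hZ' : Z ⊆ lineIco (a + k) b c l \ (X ∪ Y) :=
        (Finset.mem_powerset.1 hZ).trans (by split_ifs <;> simp)
      have hZl := hZ'.trans Finset.sdiff_subset
      rw [← tilingCount_lowerPart_hexagon hl (Finset.union_subset hY hZl)
        (fun h => by rw [hY0 h, hZ0 (.inl h)]; rfl),
        ← tilingCount_upperPart hl (Finset.union_subset hX hZl)
        (fun h => by rw [hX0 h, hZ0 (.inr h)]; rfl)]
      rw [holedHexagon_filter_lt, holedHexagon_filter_not_lt]
      ring
  · intro i
    have hh : i ∈ lineIco (a + k) b c l ↔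
      (-(b : ℤ) ≤ i ∧ -(l : ℤ) ≤ i) ∧ (i < (a + k : ℕ) ∧ i < (a + k : ℕ) + c - l) := mem_lineIco
    push_cast at hh
    have hu : upOn (i, (l : ℤ)) ∈ holedHexagon a b c k l X Y ↔
        ((0 ≤ (l : ℤ) ∧ (l : ℤ) < b + c + k) ∧ (-(b : ℤ) ≤ i ∧ i < a + k) ∧
          (0 ≤ i + l ∧ i + l < a + k + c)) ∧ i ∉ X := by
      rw [holedHexagon, Finset.mem_sdiff, Finset.mem_union, upOn, mem_hexagon_up, mem_image_upOn]
      simp only [notMem_image_downOn, or_false, and_true]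
    have hd : downOn (i, (l : ℤ)) ∈ holedHexagon a b c k l X Y ↔
        ((0 ≤ (l : ℤ) - 1 ∧ (l : ℤ) - 1 < b + c + k) ∧ (-(b : ℤ) ≤ i ∧ i < a + k) ∧
          (0 ≤ i + (l - 1 : ℤ) + 1 ∧ i + (l - 1 : ℤ) + 2 ≤ a + k + c)) ∧ i ∉ Y := by
      rw [holedHexagon, Finset.mem_sdiff, Finset.mem_union, downOn, mem_hexagon_down,
        mem_image_downOn]
      simp only [notMem_image_upOn, false_or, and_true]
    rw [hu, hd]
    split_ifs with h0
    · simp only [Finset.notMem_empty, false_iff]; omega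
    · rw [Finset.mem_sdiff, hh, Finset.mem_union]
      constructor
      · rintro ⟨h1, h2⟩; push Not at h2
        exact ⟨⟨by omega, h2.1⟩, ⟨by omega, h2.2⟩⟩
      · rintro ⟨⟨h1, h2⟩, ⟨h3, h4⟩⟩
        exact ⟨by omega, by tauto⟩

/-! ### The product formula -/

/-- A Pochhammer symbol as a quotient of products over integer intervals, of which at least one is
empty. -/
lemma poch_sub_eq (u v x : ℤ) : poch ((u : ℚ) - x) (v - u) =
    ((∏ y ∈ Finset.Ico u v, (y - x) : ℤ) : ℚ) / ((∏ y ∈ Finset.Ico v u, (y - x) : ℤ) : ℚ) := by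
  rcases le_or_gt u v with h | h
  · obtain ⟨n, rfl⟩ := Int.le.dest h
    have h1 : Finset.Ico u (u + n) = (Finset.range n).image (fun i : ℕ => u + (i : ℤ)) := by
      ext z
      simp only [Finset.mem_Ico, Finset.mem_image, Finset.mem_range]
      constructor
      · exact fun hz => ⟨(z - u).toNat, by omega, by omega⟩
      · rintro ⟨i, hi, rfl⟩; omega
    rw [add_sub_cancel_left, Finset.Ico_eq_empty (a := u + (n : ℤ)) (by omega), h1,
      Finset.prod_image (fun _ _ _ _ h => by simpa using h)]
    simp only [poch, Finset.prod_empty, Int.cast_one, div_one]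
    push_cast
    exact Finset.prod_congr rfl fun i _ => by ring
  · obtain ⟨n, hn⟩ : ∃ n : ℕ, u = v + (n + 1) := ⟨(u - v - 1).toNat, by omega⟩
    have h1 : Finset.Ico v u = (Finset.range (n + 1)).image (fun i : ℕ => u - ((i : ℤ) + 1)) := by
      ext z
      simp only [Finset.mem_Ico, Finset.mem_image, Finset.mem_range]
      constructor
      · exact fun hz => ⟨(u - z - 1).toNat, by omega, by omega⟩
      · rintro ⟨i, hi, rfl⟩; omega
    have h2 : v - u = Int.negSucc n := by rw [Int.negSucc_eq]; omega
    rw [Finset.Ico_eq_empty (a := u) (by omega), h2, h1,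
      Finset.prod_image (fun _ _ _ _ h => by simpa using h)]
    simp only [poch, Finset.prod_empty, Int.cast_one, one_div]
    push_cast
    congr 1
    exact Finset.prod_congr rfl fun i _ => by ring

/-- The substitution `y ↦ -1 - y` brings the distances to a block on the left of `x` into the form of
`poch_sub_eq`. -/
lemma prod_Ico_neg_abs_sub {u v x : ℤ} (h : -u ≤ x ∨ v ≤ u) :
    ∏ y ∈ Finset.Ico (-v) (-u), |y - x| = ∏ y ∈ Finset.Ico u v, (y - (-x - 1)) := by
  have h1 : Finset.Ico (-v) (-u) = (Finset.Ico u v).image (fun y => -1 - y) := by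
    ext z
    rw [mem_image_sub, Finset.mem_Ico, Finset.mem_Ico]; omega
  rw [h1, Finset.prod_image (fun _ _ _ _ h => by simpa using h)]
  refine Finset.prod_congr rfl fun y hy => ?_
  rw [Finset.mem_Ico] at hy
  rw [abs_of_neg (by omega)]; ring

lemma prod_Ico_abs_sub {u v x : ℤ} (h : x < u ∨ v ≤ u) :
    ∏ y ∈ Finset.Ico u v, |y - x| = ∏ y ∈ Finset.Ico u v, (y - x) := by
  refine Finset.prod_congr rfl fun y hy => ?_
  rw [Finset.mem_Ico] at hy
  exact abs_of_pos (by omega)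

/-- The abscissa of the left endpoint of the unit segment with label `t`, labelled from left to
right. -/
def labelPos (b l t : ℕ) : ℤ := -((min b l : ℕ) : ℤ) + t - 1

lemma labelPos_injective (b l : ℕ) : Function.Injective (labelPos b l) := fun s t h => by
  simpa [labelPos] using h

lemma labelPos_mem_lineIco {a b c k l t : ℕ}
    (ht : t ∈ Finset.Icc 1 (lineLength a b c k l)) : labelPos b l t ∈ lineIco (a + k) b c l := by
  rw [Finset.mem_Icc, lineLength] at ht
  rw [mem_lineIco, labelPos]
  push_cast
  omega

/-- The factor of a hole in the product formula compares the distances to the two kinds of side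
dents. -/
lemma holeFactor_eq {a b c k l t : ℕ}
    (ht : labelPos b l t ∈ lineIco (a + k) b c l) :
    holeFactor a b c k l t = (distProd (upperSideDents (a + k) b c l) (labelPos b l t) : ℚ) /
      (distProd (sideDents (a + k) b c l) (labelPos b l t) : ℚ) := by
  have hx : (t : ℤ) = labelPos b l t + min (b : ℤ) l + 1 := by
    rw [labelPos]; push_cast; ring
  have hxq : (t : ℚ) = (labelPos b l t : ℚ) + min (b : ℚ) l + 1 := by
    rw [labelPos]; push_cast; ring
  generalize labelPos b l t = x at *
  rw [mem_lineIco] at ht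
  push_cast at ht
  have hL : (t : ℚ) - b + max (b : ℚ) l = ((l : ℤ) : ℚ) - ((-x - 1 : ℤ) : ℚ) := by
    have := min_add_max (b : ℚ) l
    push_cast
    linarith
  have hR : (a : ℚ) + k + min (b : ℚ) l + 1 - t = (((a + k : ℕ) : ℤ) : ℚ) - (x : ℚ) := by
    push_cast; linarith
  have hR' : (c : ℤ) - l = ((a + k : ℕ) : ℤ) + c - l - (a + k : ℕ) := by ring
  rw [holeFactor, hL, hR, poch_sub_eq, hR', poch_sub_eq]
  have hD2 : distProd (upperSideDents (a + k) b c l) x =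
      (∏ y ∈ Finset.Ico (l : ℤ) b, (y - (-x - 1))) *
        ∏ y ∈ Finset.Ico ((a + k : ℕ) : ℤ) ((a + k : ℕ) + c - l), (y - x) := by
    rw [distProd, upperSideDents, Finset.prod_union, prod_Ico_neg_abs_sub (by omega),
      prod_Ico_abs_sub (by push_cast; omega)]
    rw [Finset.disjoint_left]
    intro y; rw [Finset.mem_Ico, Finset.mem_Ico]; omega
  have hD1 : distProd (sideDents (a + k) b c l) x =
      (∏ y ∈ Finset.Ico (b : ℤ) l, (y - (-x - 1))) *
        ∏ y ∈ Finset.Ico (((a + k : ℕ) : ℤ) + c - l) ((a + k : ℕ)), (y - x) := by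
    rw [distProd, sideDents, Finset.prod_union, prod_Ico_neg_abs_sub (by omega),
      prod_Ico_abs_sub (by push_cast; omega)]
    rw [Finset.disjoint_left]
    intro y; rw [Finset.mem_Ico, Finset.mem_Ico]; omega
  rw [hD1, hD2, div_mul_div_comm]
  push_cast
  rfl

lemma card_sideDents {n p q h : ℕ} (hpq : h ≤ p + q) :
    (sideDents n p q h).card = (h - p) + (h - q) := by
  rw [sideDents, Finset.card_union_of_disjoint, Int.card_Ico, Int.card_Ico]
  · omega
  · rw [Finset.disjoint_left]
    intro y; rw [Finset.mem_Ico, Finset.mem_Ico]; omega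

lemma card_upperSideDents (n p q h : ℕ) :
    (upperSideDents n p q h).card = (p - h) + (q - h) := by
  rw [upperSideDents, Finset.card_union_of_disjoint, Int.card_Ico, Int.card_Ico]
  · omega
  · rw [Finset.disjoint_left]
    intro y; rw [Finset.mem_Ico, Finset.mem_Ico]; omega

lemma lineIco_disjoint_upperSideDents (n p q h : ℕ) :
    Disjoint (lineIco n p q h) (upperSideDents n p q h) := by
  rw [Finset.disjoint_left]
  intro x; rw [mem_lineIco, mem_upperSideDents]; omega

/-- Exchanging the two kinds of side dents multiplies the contribution of a set `Z` of crossing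
lozenges by a factor that does not depend on `Z`. -/
lemma dentWeight_exchange {n b c k l l' m : ℕ} (hl : l + l' = b + c) {X Y Z : Finset ℤ}
    (hX : X ⊆ lineIco n b c l) (hY : Y ⊆ lineIco n b c l)
    (hXm : X.card = m + k) (hYm : Y.card = m) (hZ : Z ⊆ lineIco n b c l \ (X ∪ Y)) :
    dentWeight l (Y ∪ Z ∪ sideDents n b c l) *
        dentWeight (l' + k) (X ∪ Z ∪ upperSideDents n b c l) *
        ((∏ y ∈ Y, distProd (upperSideDents n b c l) y) * ∏ x ∈ X, distProd (sideDents n b c l) x) =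
      dentWeight l' (Y ∪ Z ∪ upperSideDents n b c l) *
        dentWeight (l + k) (X ∪ Z ∪ sideDents n b c l) *
        ((∏ y ∈ Y, distProd (sideDents n b c l) y) *
          ∏ x ∈ X, distProd (upperSideDents n b c l) x) := by
  have hZl := hZ.trans Finset.sdiff_subset
  have hXZ : Disjoint X Z := Finset.disjoint_left.2 fun x hx hxZ =>
    (Finset.mem_sdiff.1 (hZ hxZ)).2 (Finset.mem_union_left _ hx)
  have hYZ : Disjoint Y Z := Finset.disjoint_left.2 fun x hx hxZ =>
    (Finset.mem_sdiff.1 (hZ hxZ)).2 (Finset.mem_union_right _ hx)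
  have hX1 := (lineIco_disjoint_sideDents n b c l).mono_left (Finset.union_subset hX hZl)
  have hX2 := (lineIco_disjoint_upperSideDents n b c l).mono_left (Finset.union_subset hX hZl)
  have hY1 := (lineIco_disjoint_sideDents n b c l).mono_left (Finset.union_subset hY hZl)
  have hY2 := (lineIco_disjoint_upperSideDents n b c l).mono_left (Finset.union_subset hY hZl)
  simp only [dentWeight, Finset.card_union_of_disjoint hX1, Finset.card_union_of_disjoint hX2,
    Finset.card_union_of_disjoint hY1, Finset.card_union_of_disjoint hY2,
    Finset.card_union_of_disjoint hXZ, Finset.card_union_of_disjoint hYZ, hXm, hYm,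
    card_sideDents (n := n) (show l ≤ b + c by omega), card_upperSideDents]
  by_cases hz : m + Z.card + (l - b + (l - c)) = l
  · rw [if_pos hz, if_pos (by omega), if_pos (by omega), if_pos (by omega)]
    rw [vdm_union hX1, vdm_union hX2, vdm_union hY1, vdm_union hY2, Finset.prod_union hXZ,
      Finset.prod_union hXZ, Finset.prod_union hYZ, Finset.prod_union hYZ]
    ring
  · rw [if_neg hz, if_neg (show ¬ m + Z.card + (b - l + (c - l)) = l' by omega)]
    ring

/-- The tiling count of the hexagon with holes on the line at height `l'`, labelled from right to
left, as a sum over the same sets `Z` as in `tilingCount_holedHexagon`. In terms of positions,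
exchanging the two ways of labelling is the reflection `x ↦ a + k - 1 - b - x`, which maps the line
at height `l` to that at height `l'` and exchanges `sideDents` and `upperSideDents`. -/
lemma tilingCount_holedHexagon_reflect {a b c k l l' : ℕ} (hl : l + l' = b + c) {X Y : Finset ℤ}
    (hX : X ⊆ lineIco (a + k) b c l) (hY : Y ⊆ lineIco (a + k) b c l)
    (hX0 : l + k = 0 → X = ∅) (hY0 : l' = 0 → Y = ∅) :
    (hyperfactorial l' : ℤ) * hyperfactorial (l + k) *
      tilingCount (holedHexagon a b c k l' (X.image (fun x => (a : ℤ) + k - 1 - b - x))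
        (Y.image (fun x => (a : ℤ) + k - 1 - b - x))) =
      ∑ Z ∈ (lineIco (a + k) b c l \ (X ∪ Y)).powerset,
        dentWeight l' (Y ∪ Z ∪ upperSideDents (a + k) b c l) *
          dentWeight (l + k) (X ∪ Z ∪ sideDents (a + k) b c l) := by
  have hinj : Function.Injective (fun x : ℤ => (a : ℤ) + k - 1 - b - x) := fun x y h => by
    simpa using h
  have hinv : ∀ S : Finset ℤ, (S.image (fun x => (a : ℤ) + k - 1 - b - x)).image
      (fun x => (a : ℤ) + k - 1 - b - x) = S := fun S => by
    ext x; rw [mem_image_sub, mem_image_sub, sub_sub_cancel]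
  have hline : lineIco (a + k) b c l' =
      (lineIco (a + k) b c l).image (fun x => (a : ℤ) + k - 1 - b - x) := by
    ext x; rw [mem_image_sub, mem_lineIco, mem_lineIco]; push_cast; omega
  have hD1 : sideDents (a + k) b c l' =
      (upperSideDents (a + k) b c l).image (fun x => (a : ℤ) + k - 1 - b - x) := by
    ext x; rw [mem_image_sub, mem_sideDents, mem_upperSideDents]; push_cast; omega
  have hD2 : upperSideDents (a + k) b c l' =
      (sideDents (a + k) b c l).image (fun x => (a : ℤ) + k - 1 - b - x) := by
    ext x; rw [mem_image_sub, mem_sideDents, mem_upperSideDents]; push_cast; omega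
  rw [tilingCount_holedHexagon (l := l') (l' := l) (by omega)
    (hline ▸ Finset.image_subset_image hX) (hline ▸ Finset.image_subset_image hY)
    (fun h => by rw [hX0 h]; rfl) (fun h => by rw [hY0 h]; rfl), hline, hD1, hD2,
    ← Finset.image_union, ← Finset.image_sdiff _ _ hinj]
  symm
  refine Finset.sum_nbij' (fun Z => Z.image (fun x => (a : ℤ) + k - 1 - b - x))
    (fun Z => Z.image (fun x => (a : ℤ) + k - 1 - b - x)) ?_ ?_ ?_ ?_ ?_
  · exact fun Z hZ => Finset.mem_powerset.2 (Finset.image_subset_image (Finset.mem_powerset.1 hZ))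
  · intro Z hZ
    have := Finset.image_subset_image (f := fun x => (a : ℤ) + k - 1 - b - x)
      (Finset.mem_powerset.1 hZ)
    rw [hinv] at this
    exact Finset.mem_powerset.2 this
  · exact fun Z _ => hinv Z
  · exact fun Z _ => hinv Z
  · intro Z _
    rw [← Finset.image_union, ← Finset.image_union, ← Finset.image_union, ← Finset.image_union,
      dentWeight_image_sub, dentWeight_image_sub]

lemma region_eq (a b c k l : ℕ) (X Y : Finset ℕ) : region a b c k l X Y =
    holedHexagon a b c k l (X.image (labelPos b l)) (Y.image (labelPos b l)) := by
  rw [region, holedHexagon, Finset.image_image, Finset.image_image]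
  rfl

lemma regionBar_eq {a b c k l l' : ℕ} (hl : l + l' = b + c) (X Y : Finset ℕ) :
    regionBar a b c k l' X Y = holedHexagon a b c k l'
      ((X.image (labelPos b l)).image (fun x => (a : ℤ) + k - 1 - b - x))
      ((Y.image (labelPos b l)).image (fun x => (a : ℤ) + k - 1 - b - x)) := by
  have h : ∀ t, segRL a b c k l' t = ((a : ℤ) + k - 1 - b - labelPos b l t, (l' : ℤ)) := by
    intro t
    rw [segRL, labelPos, lineLength]
    congr 1
    omega
  rw [regionBar, holedHexagon, Finset.image_image, Finset.image_image, Finset.image_image,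
    Finset.image_image]
  simp only [h]
  rfl

lemma hyperfactorial_pos (n : ℕ) : 0 < hyperfactorial n :=
  Finset.prod_pos fun i _ => i.factorial_pos

/-- Positivity of the product formula and the multiplicative form of the shuffling theorem. -/
lemma productFormula_pos_and_tilingCount_region {a b c k l m : ℕ} (hl : l ≤ b + c)
    (hm : m ≤ min l (b + c - l)) {X Y : Finset ℕ}
    (hX : X ⊆ Finset.Icc 1 (lineLength a b c k l)) (hXcard : X.card = m + k)
    (hY : Y ⊆ Finset.Icc 1 (lineLength a b c k l)) (hYcard : Y.card = m) :
    0 < productFormula a b c k l X Y ∧ (tilingCount (region a b c k l X Y) : ℚ) =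
      productFormula a b c k l X Y * tilingCount (regionBar a b c k (b + c - l) X Y) := by
  obtain ⟨l', hl'⟩ : ∃ l', l + l' = b + c := ⟨b + c - l, by omega⟩
  have e1 : b + c - l = l' := by omega
  have e2 : b + c + k - l = l' + k := by omega
  have hlX : X.image (labelPos b l) ⊆ lineIco (a + k) b c l := fun x hx => by
    obtain ⟨t, ht, rfl⟩ := Finset.mem_image.1 hx
    exact labelPos_mem_lineIco (hX ht)
  have hlY : Y.image (labelPos b l) ⊆ lineIco (a + k) b c l := fun x hx => by
    obtain ⟨t, ht, rfl⟩ := Finset.mem_image.1 hx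
    exact labelPos_mem_lineIco (hY ht)
  have hXc : (X.image (labelPos b l)).card = m + k := by
    rw [Finset.card_image_of_injective _ (labelPos_injective b l), hXcard]
  have hYc : (Y.image (labelPos b l)).card = m := by
    rw [Finset.card_image_of_injective _ (labelPos_injective b l), hYcard]
  have hpos1 : ∀ S ⊆ lineIco (a + k) b c l, 0 < ∏ x ∈ S, distProd (sideDents (a + k) b c l) x :=
    fun S hS => Finset.prod_pos fun x hx => distProd_pos
      (Finset.disjoint_left.1 (lineIco_disjoint_sideDents _ _ _ _) (hS hx))
  have hpos2 : ∀ S ⊆ lineIco (a + k) b c l,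
      0 < ∏ x ∈ S, distProd (upperSideDents (a + k) b c l) x :=
    fun S hS => Finset.prod_pos fun x hx => distProd_pos
      (Finset.disjoint_left.1 (lineIco_disjoint_upperSideDents _ _ _ _) (hS hx))
  have hfac : ∀ S : Finset ℕ, S.image (labelPos b l) ⊆ lineIco (a + k) b c l →
      ∏ x ∈ S, holeFactor a b c k l x =
        ((∏ x ∈ S.image (labelPos b l), distProd (upperSideDents (a + k) b c l) x : ℤ) : ℚ) /
          ((∏ x ∈ S.image (labelPos b l), distProd (sideDents (a + k) b c l) x : ℤ) : ℚ) := by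
    intro S hS
    rw [Finset.prod_image (labelPos_injective b l).injOn,
      Finset.prod_image (labelPos_injective b l).injOn]
    push_cast
    rw [← Finset.prod_div_distrib]
    exact Finset.prod_congr rfl fun t ht => holeFactor_eq (hS (Finset.mem_image_of_mem _ ht))
  have hM := tilingCount_holedHexagon hl' hlX hlY
    (fun h => by rw [← Finset.card_eq_zero, hXc]; omega)
    (fun h => by rw [← Finset.card_eq_zero, hYc]; omega)
  have hM' := tilingCount_holedHexagon_reflect hl' hlX hlY
    (fun h => by rw [← Finset.card_eq_zero, hXc]; omega)
    (fun h => by rw [← Finset.card_eq_zero, hYc]; omega)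
  have hex := Finset.sum_congr rfl fun Z hZ =>
    dentWeight_exchange hl' hlX hlY hXc hYc (Finset.mem_powerset.1 hZ)
  rw [← Finset.sum_mul, ← Finset.sum_mul, ← hM, ← hM', ← region_eq, ← regionBar_eq hl'] at hex
  have hexq := congrArg (Int.cast : ℤ → ℚ) hex
  have pX1 := hpos1 _ hlX
  have pX2 := hpos2 _ hlX
  have pY1 := hpos1 _ hlY
  have pY2 := hpos2 _ hlY
  have q1 : (0 : ℚ) < hyperfactorial l := by exact_mod_cast hyperfactorial_pos l
  have q2 : (0 : ℚ) < hyperfactorial l' := by exact_mod_cast hyperfactorial_pos l'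
  have q3 : (0 : ℚ) < hyperfactorial (l + k) := by exact_mod_cast hyperfactorial_pos (l + k)
  have q4 : (0 : ℚ) < hyperfactorial (l' + k) := by exact_mod_cast hyperfactorial_pos (l' + k)
  rw [Int.cast_mul, Int.cast_mul, Int.cast_mul, Int.cast_mul, Int.cast_mul, Int.cast_mul,
    Int.cast_mul, Int.cast_mul] at hexq
  rw [← Int.cast_pos (R := ℚ)] at pX1 pX2 pY1 pY2
  simp only [Int.cast_natCast] at hexq
  have hP : productFormula a b c k l X Y = productFormula a b c k l X Y := rfl
  conv_rhs at hP => rw [productFormula, e1, e2, hfac X hlX, hfac Y hlY, add_comm k l]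
  rw [e1]
  generalize ((∏ x ∈ X.image (labelPos b l), distProd (sideDents (a + k) b c l) x : ℤ) : ℚ) =
    x1 at *
  generalize ((∏ x ∈ X.image (labelPos b l), distProd (upperSideDents (a + k) b c l) x : ℤ) : ℚ) =
    x2 at *
  generalize ((∏ x ∈ Y.image (labelPos b l), distProd (sideDents (a + k) b c l) x : ℤ) : ℚ) =
    y1 at *
  generalize ((∏ x ∈ Y.image (labelPos b l), distProd (upperSideDents (a + k) b c l) x : ℤ) : ℚ) =
    y2 at *
  have hpos : 0 < productFormula a b c k l X Y := by
    rw [hP]; positivity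
  have hmain : (tilingCount (region a b c k l X Y) : ℚ) =
      productFormula a b c k l X Y * tilingCount (regionBar a b c k l' X Y) := by
    rw [hP]
    field_simp
    linarith [hexq]
  exact ⟨hpos, hmain⟩

end Lozenge

theorem theorem2p1 (a b c k l m : ℕ) (hbc : b ≤ c) (hl : l ≤ b + c)
    (hm : m ≤ min b (min l (b + c - l))) (X Y : Finset ℕ)
    (hX : X ⊆ Finset.Icc 1 (Lozenge.lineLength a b c k l)) (hXcard : X.card = m + k)
    (hY : Y ⊆ Finset.Icc 1 (Lozenge.lineLength a b c k l)) (hYcard : Y.card = m) :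
    0 < Lozenge.productFormula a b c k l X Y ∧
    (Lozenge.tilingCount (Lozenge.region a b c k l X Y) : ℚ) =
      Lozenge.productFormula a b c k l X Y *
        Lozenge.tilingCount (Lozenge.regionBar a b c k (b + c - l) X Y) ∧
    (Lozenge.tilingCount (Lozenge.regionBar a b c k (b + c - l) X Y) ≠ 0 →
      (Lozenge.tilingCount (Lozenge.region a b c k l X Y) : ℚ) /
          Lozenge.tilingCount (Lozenge.regionBar a b c k (b + c - l) X Y) =
        Lozenge.productFormula a b c k l X Y) := by
  obtain ⟨hpos, hmain⟩ := Lozenge.productFormula_pos_and_tilingCount_region hl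
    (hm.trans (min_le_right _ _)) hX hXcard hY hYcard
  refine ⟨hpos, hmain, fun h => ?_⟩
  rw [hmain, mul_div_assoc, div_self (by exact_mod_cast h), mul_one]
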